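/- Let $d,T\ge 1$, $D\ge 1$, and let $\mathcal K=\{x\in\mathbb R^d:\|x\|\le D\}$ (Euclidean norm). Put $\mathcal K_\delta=\{x:\frac1{1-\delta}x\in\mathcal K\}$, $\mathcal K'_\delta=\{(x,1):x\in\mathcal K_\delta\}$ and $con(\mathcal K)=\{\mathbf 0\}\cup\{(x,b):x/b\in\mathcal K,\ b>0\}\subseteq\mathbb R^{d+1}$. Let $\mathcal R$ be a $\nu$-normal barrier on $con(\mathcal K)$: $\nu\ge1$; $\mathcal R$ is convex and three times continuously differentiable on the interior of $con(\mathcal K)$ and tends to infinity at every boundary point; and for all interior $x$, all $h\in\mathbb R^{d+1}$ and all $t>0$, with $\|h\|_x=\sqrt{h^\top\nabla^2\mathcal R(x)h}$, one has $\nabla^3\mathcal R(x)[h,h,h]\le 2\|h\|_x^3$, $|\nabla\mathcal R(x)^\top h|\le\sqrt\nu\,\|h\|_x$ and $\mathcal R(tx)=\mathcal R(x)-\nu\ln t$. Let $\epsilon\ge 0$ and let $f_1,\dots,f_T$ be losses with $f_t(x)=\theta_t^\top x+\sigma_t(x)$, $|\sigma_t(x)|\le\epsilon$ and $|f_t(x)|\le1$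 for all $x\in\mathcal K$, where the vectors $\theta_t\in\mathbb R^d$, $\|\theta_t\|\le G$, are fixed before the game, while the perturbation $\sigma_t$ may depend on the history up to and including the play of round $t$. Put $\delta=1/T^2$ if $\epsilon=0$ and $\delta=\sqrt\epsilon$ otherwise, assume $\delta<1$, and put $\eta=\frac{\sqrt{\nu\ln(1/\delta)}}{2d\sqrt T}$. SCRiBLe with lifting starts from $x'_1=\arg\min_{x'\in\mathcal K'_\delta}\mathcal R(x')$. In round $t=1,\dots,T$ it sets $\mathbf A_t=[\nabla^2\mathcal R(x'_t)]^{-1/2}$, draws $\mu_t$, given the past, uniformly from the unit vectors of $\mathbb R^{d+1}$ orthogonal to $\mathbf A_te_{d+1}$, plays $y_t$ where $(y_t,1)=x'_t+\mathbf A_t\mu_t$, observes only $f_t(y_t)$, sets $g_t=d\,f_t(y_t)\mathbf A_t^{-1}\mu_t$, and updates $x'_{t+1}=\arg\min_{x'\in\mathcal K'_\delta}\bigl(\eta\sum_{\tau=1}^t g_\tau^\top x'+\mathcal R(x')\bigr)$. Then $$\mathbb E\Bigl[\sum_{t=1}^Tf_t(y_t)-\inf_{x\in\mathcal K}\sum_{t=1}^Tf_t(x)\Bigr]\le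 4d\sqrt{\nu T\ln\tfrac1\delta}+2dT(\nu+2\sqrt\nu)\tfrac{1-\delta}{\delta}\epsilon+\delta GDT+2T\epsilon .$$ Moreover, the right-hand side is at most $C\bigl(\sqrt{\ln(1/\delta)}\,d\sqrt T+\sqrt\epsilon\,dT+\epsilon dT\bigr)$ with a constant $C$ that depends only on $\nu$, $G$ and $D$; that is, it is $\tilde O(d\sqrt T+\sqrt\epsilon\,dT+\epsilon dT)$. -/

import Mathlib

open MeasureTheory ProbabilityTheory Filter Topology
open scoped Matrix

noncomputable section

namespace BanditLifting

/-- Euclidean space `ℝⁿ` with the `2`-norm. -/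
abbrev Vec (n : ℕ) : Type := EuclideanSpace ℝ (Fin n)

/-- The point `(x, b)` of `ℝ^(d+1)`, for `x ∈ ℝ^d` and `b ∈ ℝ`. -/
def pair {d : ℕ} (x : Vec d) (b : ℝ) : Vec (d + 1) :=
  WithLp.toLp 2 (Fin.snoc (α := fun _ => ℝ) (fun i => x i) b)

/-- The first `d` coordinates of a point of `ℝ^(d+1)`. -/
def firstCoords {d : ℕ} (z : Vec (d + 1)) : Vec d :=
  WithLp.toLp 2 (fun i => z i.castSucc)

/-- The product of a matrix and a vector of Euclidean space. -/
def mulVecE {n : ℕ} (A : Matrix (Fin n) (Fin n) ℝ) (z : Vec n) : Vec n :=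
  WithLp.toLp 2 (A *ᵥ z.ofLp)

/-! ### Normal barriers -/

/-- The Hessian matrix `∇²R(x)`. -/
def hessian {n : ℕ} (R : Vec n → ℝ) (x : Vec n) : Matrix (Fin n) (Fin n) ℝ :=
  Matrix.of fun i j =>
    iteratedFDeriv ℝ 2 R x ![EuclideanSpace.single i 1, EuclideanSpace.single j 1]

/-- The local norm `‖h‖_x = √(hᵀ ∇²R(x) h)`. -/
def localNorm {n : ℕ} (R : Vec n → ℝ) (x h : Vec n) : ℝ :=
  √(inner ℝ h (mulVecE (hessian R x) h))

/-- `Ψ` is a closed and proper convex cone: closed, convex, stable under nonnegative scaling,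
pointed (it contains no line) and with nonempty interior. -/
structure IsClosedProperCone {n : ℕ} (Ψ : Set (Vec n)) : Prop where
  isClosed : IsClosed Ψ
  convex : Convex ℝ Ψ
  smul_mem : ∀ x ∈ Ψ, ∀ c : ℝ, 0 ≤ c → c • x ∈ Ψ
  pointed : ∀ x ∈ Ψ, -x ∈ Ψ → x = 0
  nonempty_interior : (interior Ψ).Nonempty

/-- `R` is a `ν`-logarithmically homogeneous self-concordant barrier (a `ν`-normal barrier) on the
closed and proper convex cone `Ψ`. Only the values of `R` on the interior of `Ψ` matter. -/
structure IsNormalBarrier {n : ℕ} (Ψ : Set (Vec n)) (ν : ℝ) (R : Vec n → ℝ) : Prop where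
  cone : IsClosedProperCone Ψ
  one_le : 1 ≤ ν
  contDiffOn : ContDiffOn ℝ 3 R (interior Ψ)
  convexOn : ConvexOn ℝ (interior Ψ) R
  tendsto_atTop : ∀ z ∈ frontier Ψ, Tendsto R (𝓝[interior Ψ] z) atTop
  third_le : ∀ x ∈ interior Ψ, ∀ h : Vec n,
    iteratedFDeriv ℝ 3 R x ![h, h, h] ≤ 2 * localNorm R x h ^ 3
  grad_le : ∀ x ∈ interior Ψ, ∀ h : Vec n, |fderiv ℝ R x h| ≤ √ν * localNorm R x h
  log_homogeneous : ∀ x ∈ interior Ψ, ∀ t : ℝ, 0 < t → R (t • x) = R x - ν * Real.log t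

/-! ### The decision sets -/

/-- `con(K) = {0} ∪ {(x, b) : x / b ∈ K, b > 0}`. -/
def con {d : ℕ} (K : Set (Vec d)) : Set (Vec (d + 1)) :=
  {0} ∪ {z | ∃ (x : Vec d) (b : ℝ), 0 < b ∧ (1 / b) • x ∈ K ∧ z = pair x b}

/-- `K_δ = {x : x / (1 - δ) ∈ K}`. -/
def shrink {d : ℕ} (δ : ℝ) (K : Set (Vec d)) : Set (Vec d) :=
  {x | (1 / (1 - δ)) • x ∈ K}

/-- The lifted set `S' = {(x, 1) : x ∈ S}`. -/
def lift {d : ℕ} (S : Set (Vec d)) : Set (Vec (d + 1)) :=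
  {z | ∃ x ∈ S, z = pair x 1}

/-! ### Losses and regret -/

/-- `f` is `ε`-approximately linear on `K` with linear part `θ`:
the perturbation `σ(x) = f(x) - θᵀx` satisfies `|σ(x)| ≤ ε` on `K`. -/
def IsApproxLinear {d : ℕ} (K : Set (Vec d)) (ε : ℝ) (θ : Vec d) (f : Vec d → ℝ) : Prop :=
  ∀ x ∈ K, |f x - inner ℝ θ x| ≤ ε

/-- The regret of the plays `y 0, …, y (T-1)` against the losses `f 0, …, f (T-1)`. -/
def regret {d : ℕ} (K : Set (Vec d)) (T : ℕ) (f : ℕ → Vec d → ℝ) (y : ℕ → Vec d) : ℝ :=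
  ∑ t ∈ Finset.range T, f t (y t) - ⨅ x : K, ∑ t ∈ Finset.range T, f t x

/-! ### Uniform sampling -/

/-- The uniform probability measure on the unit sphere of a Euclidean space `E`: the normalized
surface measure. -/
def uniformSphere (E : Type*) [NormedAddCommGroup E] [InnerProductSpace ℝ E]
    [FiniteDimensional ℝ E] [MeasurableSpace E] [BorelSpace E] :
    Measure (Metric.sphere (0 : E) 1) :=
  ((volume : Measure E).toSphere Set.univ)⁻¹ • (volume : Measure E).toSphere

/-- The uniform probability measure on `S ∩ v^⊥`, where `S` is the unit sphere of `ℝⁿ`,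
as a measure on `ℝⁿ`. -/
def uniformPerp {n : ℕ} (v : Vec n) : Measure (Vec n) :=
  (uniformSphere ((ℝ ∙ v)ᗮ : Submodule ℝ (Vec n))).map fun s => (s.1 : Vec n)

/-! ### SCRiBLe with lifting -/

/-- `A = [∇²R(x')]^(-1/2)`, through the spectral calculus of symmetric matrices. -/
def scaling {n : ℕ} (R : Vec n → ℝ) (x' : Vec n) : Matrix (Fin n) (Fin n) ℝ :=
  cfc (fun s : ℝ => s ^ (-(1 / 2) : ℝ)) (hessian R x')

/-- The point `y` that is played, where `(y, 1) = x' + A u`. -/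
def play {d : ℕ} (R : Vec (d + 1) → ℝ) (x' u : Vec (d + 1)) : Vec d :=
  firstCoords (x' + mulVecE (scaling R x') u)

/-- The estimator `g = d f(y) A⁻¹ u`. -/
def estimator {d : ℕ} (R : Vec (d + 1) → ℝ) (f : Vec d → ℝ) (x' u : Vec (d + 1)) :
    Vec (d + 1) :=
  ((d : ℝ) * f (play R x' u)) • mulVecE (scaling R x')⁻¹ u

/-- `(x', u)` is a run of SCRiBLe with lifting for `T` rounds, with parameters `η`, `δ` and the
barrier `R`, against the (possibly random) losses `f`. Rounds are numbered from `0`.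
The `σ`-algebra `ℱ t` is the information available before the draw of round `t`. -/
structure IsRun {Ω : Type*} [mΩ : MeasurableSpace Ω] (P : Measure Ω) {d : ℕ} (T : ℕ)
    (K : Set (Vec d)) (η δ : ℝ) (R : Vec (d + 1) → ℝ) (f : ℕ → Ω → Vec d → ℝ)
    (ℱ : Filtration ℕ mΩ) (x' u : ℕ → Ω → Vec (d + 1)) : Prop where
  /-- `x'_t` is known before the draw of round `t`. -/
  measurable_x : ∀ t < T, Measurable[ℱ t] (x' t)
  /-- The direction drawn in round `t` is known after round `t`. -/
  measurable_u : ∀ t < T, Measurable[ℱ (t + 1)] (u t)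
  /-- The loss observed in round `t` is known after round `t`. -/
  measurable_loss : ∀ t < T,
    Measurable[ℱ (t + 1)] (fun ω => f t ω (play R (x' t ω) (u t ω)))
  /-- `x'_t` minimizes `η ∑_{τ < t} g_τᵀ z + R(z)` over the lifted set `K'_δ`. -/
  mem : ∀ t < T, ∀ ω, x' t ω ∈ lift (shrink δ K)
  isMinOn : ∀ t < T, ∀ ω,
    IsMinOn (fun z => η * ∑ τ ∈ Finset.range t,
      inner ℝ (estimator R (f τ ω) (x' τ ω) (u τ ω)) z + R z) (lift (shrink δ K)) (x' t ω)
  /-- Given the past, `u_t` is uniform on the unit sphere intersected with `(A_t e_{d+1})^⊥`. -/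
  uniform : ∀ t < T, ∀ B : Set (Vec (d + 1)), MeasurableSet B →
    P[(u t ⁻¹' B).indicator (fun _ => (1 : ℝ)) | ℱ t] =ᵐ[P] fun ω =>
      (uniformPerp (mulVecE (scaling R (x' t ω))
        (EuclideanSpace.single (Fin.last d) 1))).real B

/-! ### Parameters and bound -/

/-- `δ = 1 / T²` if `ε = 0`, and `δ = √ε` otherwise. -/
def deltaParam (T : ℕ) (ε : ℝ) : ℝ := if ε = 0 then 1 / (T : ℝ) ^ 2 else √ε

/-- `η = √(ν ln(1/δ)) / (2 d √T)`. -/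
def etaParam (d T : ℕ) (ν δ : ℝ) : ℝ := √(ν * Real.log (1 / δ)) / (2 * d * √T)

/-- `4d√(νT ln(1/δ)) + 2dT(ν + 2√ν)((1-δ)/δ)ε + δGDT + 2Tε`. -/
def regretBound (d T : ℕ) (ν G D ε δ : ℝ) : ℝ :=
  4 * d * √(ν * T * Real.log (1 / δ)) + 2 * d * T * (ν + 2 * √ν) * ((1 - δ) / δ) * ε
    + δ * G * D * T + 2 * T * ε

end BanditLifting

end

/-!
Fix one sequence of draws. As `f_t` is `θ_tᵀx` up to `ε`, the regret is at most
`∑ θ_tᵀ(y_t - (1 - δ) x⋆)` up to `δGDT + 2Tε`, where `x⋆` minimizes `∑ θ_tᵀx` over `K`. In round `t`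
replace `θ_tᵀ(y_t - (1 - δ) x⋆)` by `g_tᵀ(x'_t - z)` with `z = ((1 - δ) x⋆, 1)`. There are two
errors.

* For the linear part, `roundError`, the error has conditional mean zero: on the unit sphere of the
  `d`-dimensional space `(A_t e_{d+1})^⊥` the second moment of `u` is `1 / d` times the identity.
* The perturbation enters `g_t` with a factor `d`, and costs at most `dε` times the local norm of
  `x'_t - z`. Logarithmic homogeneity bounds the local norm of `z - x` at `x` by `ν` when
  `∇R(x)ᵀ(z - x) ≥ 0`. Otherwise reflect: `x + s(x - z)` is still interior for `s` of order
  `δ / (1 - δ)`, so the bound is `ν / s`.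

The sum of the `g_tᵀ(x'_t - z)` is the regret of follow-the-regularized-leader with regularizer `R`.
By the "be the leader" inequality it is at most the oscillation of `R` on `K'_δ` over `η` plus the
gain of looking one round ahead. Logarithmic homogeneity bounds the oscillation by a multiple of
`ν ln(1/δ)`. Self-concordance makes the objective grow by at least `a - ln(1 + a)` at local distance
`a` from the leader, so that looking ahead gains `O(ηd²)` per round if `ηd ≤ 1/4`. That condition
holds unless `T ≤ 4d²ν ln(1/δ)`, and in this case, as for `δ > 1/2`, the claimed bound exceeds the
trivial bound `2T`.
-/

noncomputable section

namespace BanditLifting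

/-! ### Second derivatives of convex functions -/

section SecondDeriv

variable {E : Type*} [NormedAddCommGroup E] [NormedSpace ℝ E] {f : E → ℝ} {U : Set E} {x y h : E}

/-- The second derivative `D²f(x)[h, k]`. For functions on `ℝⁿ` it is the bilinear form of
`hessian f x`, and it is the form in which Hessians enter the proofs. -/
def secondDeriv (f : E → ℝ) (x h k : E) : ℝ := fderiv ℝ (fderiv ℝ f) x h k

lemma secondDeriv_smul_smul (f : E → ℝ) (x h : E) (s : ℝ) :
    secondDeriv f x (s • h) (s • h) = s ^ 2 * secondDeriv f x h h := by
  simp [secondDeriv]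
  ring

lemma secondDeriv_comm (hf : ContDiffAt ℝ 2 f x) (h k : E) :
    secondDeriv f x h k = secondDeriv f x k h :=
  (hf.isSymmSndFDerivAt (by simp)).eq h k

lemma hasDerivAt_add_smul (x h : E) (s : ℝ) : HasDerivAt (fun s : ℝ => x + s • h) h s := by
  simpa using ((hasDerivAt_id s).smul_const h).const_add x

lemma fderiv_sub_le_of_convexOn {f' : E →L[ℝ] ℝ} (hf : ConvexOn ℝ U f) (hd : HasFDerivAt f f' x)
    (hx : x ∈ U) (hy : y ∈ U) : f' (y - x) ≤ f y - f x := by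
  have hline : HasDerivAt (fun s : ℝ => f (x + s • (y - x))) (f' (y - x)) 0 :=
    HasFDerivAt.comp_hasDerivAt 0 (by simpa using hd) (hasDerivAt_add_smul x (y - x) 0)
  have hconv : ConvexOn ℝ (AffineMap.lineMap x y ⁻¹' U) (f ∘ AffineMap.lineMap (k := ℝ) x y) :=
    hf.comp_affineMap _
  have hcomp : f ∘ AffineMap.lineMap (k := ℝ) x y = fun s : ℝ => f (x + s • (y - x)) := by
    ext s
    simp only [Function.comp_apply, AffineMap.lineMap_apply_module', add_comm]
  have := (hcomp ▸ hconv).le_slope_of_hasDerivAt (y := 1) (by simpa using hx) (by simpa using hy)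
    one_pos hline
  simpa [slope_def_field] using this

lemma hasDerivAt_fderiv_add_smul {s : ℝ} (hf : ContDiffAt ℝ 2 f (x + s • h)) (k : E) :
    HasDerivAt (fun s : ℝ => fderiv ℝ f (x + s • h) k) (secondDeriv f (x + s • h) h k) s := by
  have hd : HasFDerivAt (fderiv ℝ f) (fderiv ℝ (fderiv ℝ f) (x + s • h)) (x + s • h) :=
    ((hf.fderiv_right (m := 1) (by norm_num)).differentiableAt (by norm_num)).hasFDerivAt
  have := (hd.clm_apply (hasFDerivAt_const k _)).comp_hasDerivAt s (hasDerivAt_add_smul x h s)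
  exact this.congr_deriv (by simp [secondDeriv])

lemma secondDeriv_nonneg_of_convexOn (hU : IsOpen U) (hf : ConvexOn ℝ U f)
    (hf2 : ContDiffOn ℝ 2 f U) (hx : x ∈ U) (h : E) : 0 ≤ secondDeriv f x h h := by
  have hcd : ∀ z ∈ U, ContDiffAt ℝ 2 f z := fun z hz => hf2.contDiffAt (hU.mem_nhds hz)
  have hfd : ∀ z ∈ U, HasFDerivAt f (fderiv ℝ f z) z := fun z hz =>
    ((hcd z hz).differentiableAt (by norm_num)).hasFDerivAt
  let A : Set ℝ := {s | x + s • h ∈ U}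
  have hA : IsOpen A := hU.preimage (by fun_prop)
  have h0 : (0 : ℝ) ∈ A := by simpa [A] using hx
  have hmono : MonotoneOn (fun s : ℝ => fderiv ℝ f (x + s • h) h) A := by
    intro a ha b hb hab
    rcases hab.eq_or_lt with rfl | hab
    · rfl
    have h1 := fderiv_sub_le_of_convexOn hf (hfd _ ha) ha hb
    have h2 := fderiv_sub_le_of_convexOn hf (hfd _ hb) hb ha
    rw [add_sub_add_left_eq_sub, ← sub_smul, map_smul, smul_eq_mul] at h1 h2
    nlinarith
  have hacc : AccPt (0 : ℝ) (𝓟 A) := by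
    simpa using (PerfectSpace.univ_preperfect 0 trivial).nhds_inter (hA.mem_nhds h0)
  have hd := hasDerivAt_fderiv_add_smul (x := x) (h := h) (s := 0) (by simpa using hcd x hx) h
  simpa using hd.hasDerivWithinAt.nonneg_of_monotoneOn hacc hmono

end SecondDeriv

/-! ### Hessians and local norms -/

section LocalNorm

variable {n : ℕ}

lemma hessian_apply (R : Vec n → ℝ) (x : Vec n) (i j : Fin n) :
    hessian R x i j =
      secondDeriv R x (EuclideanSpace.single i 1) (EuclideanSpace.single j 1) := by
  simp [hessian, secondDeriv, iteratedFDeriv_two_apply]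

lemma inner_mulVecE_hessian (R : Vec n → ℝ) (x h k : Vec n) :
    inner ℝ h (mulVecE (hessian R x) k) = secondDeriv R x h k := by
  have hsum (w : Vec n) : w = ∑ i, w i • EuclideanSpace.single i (1 : ℝ) := by
    simpa using ((EuclideanSpace.basisFun (Fin n) ℝ).sum_repr w).symm
  have hexpand : secondDeriv R x h k = ∑ i, ∑ j, h i * k j *
      secondDeriv R x (EuclideanSpace.single i 1) (EuclideanSpace.single j 1) := by
    conv_lhs => rw [hsum h, hsum k]
    simp only [secondDeriv, map_sum, map_smul, sum_apply, smul_apply, smul_eq_mul, Finset.mul_sum]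
    rw [Finset.sum_comm]
    exact Finset.sum_congr rfl fun i _ => Finset.sum_congr rfl fun j _ => by ring
  rw [hexpand]
  simp only [mulVecE, PiLp.inner_apply, Matrix.mulVec, dotProduct, hessian_apply,
    RCLike.inner_apply, conj_trivial, Finset.sum_mul]
  exact Finset.sum_congr rfl fun i _ => Finset.sum_congr rfl fun j _ => by ring

lemma localNorm_eq_sqrt (R : Vec n → ℝ) (x h : Vec n) :
    localNorm R x h = √(secondDeriv R x h h) := by
  rw [localNorm, inner_mulVecE_hessian]

lemma localNorm_nonneg (R : Vec n → ℝ) (x h : Vec n) : 0 ≤ localNorm R x h :=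
  Real.sqrt_nonneg _

lemma localNorm_smul (R : Vec n → ℝ) (x h : Vec n) (s : ℝ) :
    localNorm R x (s • h) = |s| * localNorm R x h := by
  rw [localNorm_eq_sqrt, localNorm_eq_sqrt, secondDeriv_smul_smul, Real.sqrt_mul (sq_nonneg s),
    Real.sqrt_sq_eq_abs]

lemma localNorm_neg (R : Vec n → ℝ) (x h : Vec n) : localNorm R x (-h) = localNorm R x h := by
  simpa using localNorm_smul R x h (-1)

end LocalNorm

/-! ### Self-concordant functions -/

/-- Self-concordance on the open set `U`, with the usual constant `2`. Neither blow-up at the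
boundary of `U` nor nondegeneracy of the Hessian is required. -/
structure IsSelfConcordantOn {n : ℕ} (U : Set (Vec n)) (R : Vec n → ℝ) : Prop where
  isOpen : IsOpen U
  convexOn : ConvexOn ℝ U R
  contDiffOn : ContDiffOn ℝ 3 R U
  third_le : ∀ x ∈ U, ∀ h : Vec n, iteratedFDeriv ℝ 3 R x ![h, h, h] ≤ 2 * localNorm R x h ^ 3

namespace IsSelfConcordantOn

variable {n : ℕ} {U : Set (Vec n)} {R : Vec n → ℝ} {x h : Vec n} {r s : ℝ}

lemma contDiffAt (hR : IsSelfConcordantOn U R) (hx : x ∈ U) : ContDiffAt ℝ 3 R x :=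
  hR.contDiffOn.contDiffAt (hR.isOpen.mem_nhds hx)

lemma hasFDerivAt (hR : IsSelfConcordantOn U R) (hx : x ∈ U) :
    HasFDerivAt R (fderiv ℝ R x) x :=
  ((hR.contDiffAt hx).differentiableAt (by norm_num)).hasFDerivAt

lemma contDiffAt_fderiv_fderiv (hR : IsSelfConcordantOn U R) (hx : x ∈ U) :
    ContDiffAt ℝ 1 (fderiv ℝ (fderiv ℝ R)) x :=
  ((hR.contDiffAt hx).fderiv_right (m := 2) (by norm_num)).fderiv_right (by norm_num)

lemma hasDerivAt_add_smul (hR : IsSelfConcordantOn U R) (hxs : x + s • h ∈ U) :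
    HasDerivAt (fun s : ℝ => R (x + s • h)) (fderiv ℝ R (x + s • h) h) s :=
  (hR.hasFDerivAt hxs).comp_hasDerivAt s (BanditLifting.hasDerivAt_add_smul x h s)

lemma hasDerivAt_secondDeriv_add_smul (hR : IsSelfConcordantOn U R) (hxs : x + s • h ∈ U) :
    HasDerivAt (fun s : ℝ => secondDeriv R (x + s • h) h h)
      (iteratedFDeriv ℝ 3 R (x + s • h) ![h, h, h]) s := by
  have hsecond : DifferentiableAt ℝ (fun y => secondDeriv R y h h) (x + s • h) :=
    (((hR.contDiffAt_fderiv_fderiv hxs).differentiableAt (by norm_num)).clm_apply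
      (differentiableAt_const h)).clm_apply (differentiableAt_const h)
  have hiterated : DifferentiableAt ℝ (iteratedFDeriv ℝ 2 R) (x + s • h) :=
    ((hR.contDiffAt hxs).iteratedFDeriv_right (m := 1) (i := 2)
      (by norm_num)).differentiableAt (by norm_num)
  have htail : (fun y => iteratedFDeriv ℝ 2 R y (Fin.tail ![h, h, h])) =
      fun y => secondDeriv R y h h := by
    funext y
    rw [iteratedFDeriv_two_apply]
    rfl
  rw [hiterated.iteratedFDeriv_succ_apply_left', htail]
  exact hsecond.hasFDerivAt.comp_hasDerivAt s (BanditLifting.hasDerivAt_add_smul x h s)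

lemma localNorm_sq (hR : IsSelfConcordantOn U R) (hx : x ∈ U) (h : Vec n) :
    localNorm R x h ^ 2 = secondDeriv R x h h := by
  rw [localNorm_eq_sqrt, Real.sq_sqrt (secondDeriv_nonneg_of_convexOn hR.isOpen hR.convexOn
    (hR.contDiffOn.of_le (by norm_num)) hx h)]

lemma abs_third_le (hR : IsSelfConcordantOn U R) (hx : x ∈ U) (h : Vec n) :
    |iteratedFDeriv ℝ 3 R x ![h, h, h]| ≤ 2 * localNorm R x h ^ 3 := by
  have hneg := hR.third_le x hx (-h)
  have hvec : (![-h, -h, -h] : Fin 3 → Vec n) =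
      fun i => (-1 : ℝ) • (![h, h, h] : Fin 3 → Vec n) i := by
    funext i
    fin_cases i <;> simp
  rw [hvec, ContinuousMultilinearMap.map_smul_univ, localNorm_neg, Fin.prod_const,
    smul_eq_mul] at hneg
  exact abs_le.2 ⟨by linarith, hR.third_le x hx h⟩

lemma add_smul_mem (hR : IsSelfConcordantOn U R) (hx : x ∈ U) (hxs : x + s • h ∈ U)
    (hr : 0 ≤ r) (hrs : r ≤ s) : x + r • h ∈ U := by
  rcases hr.eq_or_lt with rfl | hr
  · simpa using hx
  have hs : 0 < s := hr.trans_le hrs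
  have := hR.convexOn.1.add_smul_mem hx hxs (t := r / s) ⟨by positivity, (div_le_one hs).2 hrs⟩
  rwa [smul_smul, div_mul_cancel₀ _ hs.ne'] at this

-- The quadratic form `q` along the line satisfies `|q'| ≤ 2 q^(3/2)`, so Grönwall's inequality
-- applies: a zero of `q` propagates.
lemma localNorm_add_smul_eq_zero (hR : IsSelfConcordantOn U R) (hx : x ∈ U) (hs : 0 ≤ s)
    (hxs : x + s • h ∈ U) (h0 : localNorm R x h = 0) : localNorm R (x + s • h) h = 0 := by
  have hmem : ∀ t ∈ Set.Icc 0 s, x + t • h ∈ U := fun t ht => hR.add_smul_mem hx hxs ht.1 ht.2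
  have hcont : ContinuousOn (fun t : ℝ => secondDeriv R (x + t • h) h h) (Set.Icc 0 s) :=
    fun t ht => (hR.hasDerivAt_secondDeriv_add_smul (hmem t ht)).continuousAt.continuousWithinAt
  obtain ⟨C, hC⟩ := isCompact_Icc.exists_bound_of_continuousOn hcont.sqrt
  have hbound : ∀ t ∈ Set.Ico 0 s, ‖iteratedFDeriv ℝ 3 R (x + t • h) ![h, h, h]‖ ≤
      2 * C * ‖secondDeriv R (x + t • h) h h‖ := by
    intro t ht
    have htU := hmem t (Set.Ico_subset_Icc_self ht)
    have hCt := hC t (Set.Ico_subset_Icc_self ht)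
    rw [← localNorm_eq_sqrt, Real.norm_of_nonneg (localNorm_nonneg _ _ _)] at hCt
    calc ‖iteratedFDeriv ℝ 3 R (x + t • h) ![h, h, h]‖
        ≤ 2 * localNorm R (x + t • h) h ^ 3 := hR.abs_third_le htU h
      _ = 2 * localNorm R (x + t • h) h * localNorm R (x + t • h) h ^ 2 := by ring
      _ ≤ 2 * C * localNorm R (x + t • h) h ^ 2 := by gcongr
      _ = 2 * C * ‖secondDeriv R (x + t • h) h h‖ := by
        rw [← hR.localNorm_sq htU, Real.norm_of_nonneg (sq_nonneg _)]
  have hzero := eq_zero_of_abs_deriv_le_mul_abs_self_of_eq_zero_right hcont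
    (fun t ht => (hR.hasDerivAt_secondDeriv_add_smul
      (hmem t (Set.Ico_subset_Icc_self ht))).hasDerivWithinAt)
    (by simp [← hR.localNorm_sq hx, h0]) hbound s ⟨hs, le_rfl⟩
  rw [localNorm_eq_sqrt, hzero, Real.sqrt_zero]

lemma localNorm_add_smul_pos (hR : IsSelfConcordantOn U R) (hx : x ∈ U) (hs : 0 ≤ s)
    (hxs : x + s • h ∈ U) (hpos : 0 < localNorm R x h) : 0 < localNorm R (x + s • h) h := by
  refine (localNorm_nonneg _ _ _).lt_of_ne' fun h0 => hpos.ne' ?_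
  have hback : x + s • h + s • -h = x := by module
  have := hR.localNorm_add_smul_eq_zero (h := -h) hxs hs (by rwa [hback])
    (by rwa [localNorm_neg])
  rwa [hback, localNorm_neg] at this

lemma abs_inv_localNorm_sub_le (hR : IsSelfConcordantOn U R) (hx : x ∈ U) (hs : 0 ≤ s)
    (hxs : x + s • h ∈ U) (hpos : 0 < localNorm R x h) :
    |(localNorm R (x + s • h) h)⁻¹ - (localNorm R x h)⁻¹| ≤ s := by
  have hmem : ∀ t ∈ Set.Icc 0 s, x + t • h ∈ U := fun t ht => hR.add_smul_mem hx hxs ht.1 ht.2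
  have hne : ∀ t ∈ Set.Icc 0 s, 0 < localNorm R (x + t • h) h := fun t ht =>
    hR.localNorm_add_smul_pos hx ht.1 (hmem t ht) hpos
  have hder : ∀ t ∈ Set.Icc 0 s, HasDerivWithinAt (fun t : ℝ => (localNorm R (x + t • h) h)⁻¹)
      (-(iteratedFDeriv ℝ 3 R (x + t • h) ![h, h, h] / (2 * localNorm R (x + t • h) h)) /
        localNorm R (x + t • h) h ^ 2) (Set.Icc 0 s) t := by
    intro t ht
    have hsqrt := (hR.hasDerivAt_secondDeriv_add_smul (hmem t ht)).sqrt
      (by rw [← hR.localNorm_sq (hmem t ht)]; exact (pow_pos (hne t ht) 2).ne')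
    simp only [← localNorm_eq_sqrt] at hsqrt
    exact (hsqrt.inv (hne t ht).ne').hasDerivWithinAt
  have hbound : ∀ t ∈ Set.Icc 0 s,
      ‖-(iteratedFDeriv ℝ 3 R (x + t • h) ![h, h, h] / (2 * localNorm R (x + t • h) h)) /
        localNorm R (x + t • h) h ^ 2‖ ≤ 1 := by
    intro t ht
    have hp := hne t ht
    rw [Real.norm_eq_abs, abs_div, abs_neg, abs_div, abs_of_pos (pow_pos hp 2),
      abs_of_pos (mul_pos two_pos hp), div_div, div_le_one (by positivity)]
    exact (hR.abs_third_le (hmem t ht) h).trans_eq (by ring)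
  simpa [abs_of_nonneg hs] using Convex.norm_image_sub_le_of_norm_hasDerivWithin_le hder hbound
    (convex_Icc 0 s) (Set.left_mem_Icc.2 hs) (Set.right_mem_Icc.2 hs)

lemma localNorm_div_le (hR : IsSelfConcordantOn U R) (hx : x ∈ U) (hs : 0 ≤ s)
    (hxs : x + s • h ∈ U) :
    localNorm R x h / (1 + s * localNorm R x h) ≤ localNorm R (x + s • h) h := by
  rcases (localNorm_nonneg R x h).eq_or_lt with h0 | hpos
  · simpa [← h0] using localNorm_nonneg R (x + s • h) h
  have hsub := (abs_le.1 (hR.abs_inv_localNorm_sub_le hx hs hxs hpos)).2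
  have hinv : (localNorm R (x + s • h) h)⁻¹ ≤ (1 + s * localNorm R x h) / localNorm R x h := by
    rw [add_div, mul_div_assoc, div_self hpos.ne', one_div]
    linarith
  have := inv_anti₀ (inv_pos.2 (hR.localNorm_add_smul_pos hx hs hxs hpos)) hinv
  rwa [inv_inv, inv_div] at this

lemma localNorm_mul_le (hR : IsSelfConcordantOn U R) (hx : x ∈ U) (hs : 0 ≤ s)
    (hxs : x + s • h ∈ U) :
    localNorm R (x + s • h) h * (1 - s * localNorm R x h) ≤ localNorm R x h := by
  rcases (localNorm_nonneg R x h).eq_or_lt with h0 | hpos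
  · simp [hR.localNorm_add_smul_eq_zero hx hs hxs h0.symm, ← h0]
  have hsub := (abs_le.1 (hR.abs_inv_localNorm_sub_le hx hs hxs hpos)).1
  have hpos' := hR.localNorm_add_smul_pos hx hs hxs hpos
  calc localNorm R (x + s • h) h * (1 - s * localNorm R x h)
      = localNorm R x h * localNorm R (x + s • h) h * ((localNorm R x h)⁻¹ - s) := by
        field_simp
    _ ≤ localNorm R x h * localNorm R (x + s • h) h * (localNorm R (x + s • h) h)⁻¹ := by
        gcongr
        linarith
    _ = localNorm R x h := by field_simp

lemma sq_div_le_fderiv_sub (hR : IsSelfConcordantOn U R) (hx : x ∈ U) (hs : 0 ≤ s)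
    (hxs : x + s • h ∈ U) :
    localNorm R x h ^ 2 * s / (1 + localNorm R x h * s) ≤
      fderiv ℝ R (x + s • h) h - fderiv ℝ R x h := by
  let a := localNorm R x h
  have ha : 0 ≤ a := localNorm_nonneg _ _ _
  have hmem : ∀ t ∈ Set.Icc 0 s, x + t • h ∈ U := fun t ht => hR.add_smul_mem hx hxs ht.1 ht.2
  have hden : ∀ t ∈ Set.Icc 0 s, 0 < 1 + a * t := fun t ht => by
    have := mul_nonneg ha ht.1
    linarith
  have hlower : ∀ t ∈ Set.Icc 0 s,
      HasDerivAt (fun t : ℝ => a ^ 2 * t / (1 + a * t)) ((a / (1 + a * t)) ^ 2) t := by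
    intro t ht
    have hnum : HasDerivAt (fun t : ℝ => a ^ 2 * t) (a ^ 2) t := by
      simpa using (hasDerivAt_id t).const_mul (a ^ 2)
    have hdenom : HasDerivAt (fun t : ℝ => 1 + a * t) a t := by
      simpa using ((hasDerivAt_id t).const_mul a).const_add 1
    refine (hnum.div hdenom (hden t ht).ne').congr_deriv ?_
    rw [div_pow]
    congr 1
    ring
  have hder : ∀ t ∈ Set.Icc 0 s,
      HasDerivAt (fun t : ℝ => fderiv ℝ R (x + t • h) h - a ^ 2 * t / (1 + a * t))
        (secondDeriv R (x + t • h) h h - (a / (1 + a * t)) ^ 2) t := fun t ht =>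
    (hasDerivAt_fderiv_add_smul ((hR.contDiffAt (hmem t ht)).of_le (by norm_num)) h).sub
      (hlower t ht)
  have hmono := monotoneOn_of_deriv_nonneg (convex_Icc 0 s)
    (fun t ht => (hder t ht).continuousAt.continuousWithinAt)
    (fun t ht => (hder t (interior_subset ht)).differentiableAt.differentiableWithinAt)
    (fun t ht => by
      have ht' := interior_subset ht
      rw [(hder t ht').deriv, sub_nonneg, ← hR.localNorm_sq (hmem t ht')]
      have hle := hR.localNorm_div_le hx ht'.1 (hmem t ht')
      rw [mul_comm t] at hle
      exact pow_le_pow_left₀ (div_nonneg ha (hden t ht').le) hle 2)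
  have hends := hmono (Set.left_mem_Icc.2 hs) (Set.right_mem_Icc.2 hs) hs
  simp only [zero_smul, add_zero, mul_zero, zero_div, sub_zero] at hends
  linarith

lemma localNorm_sub_log_le (hR : IsSelfConcordantOn U R) (hx : x ∈ U) (hxh : x + h ∈ U) :
    localNorm R x h - Real.log (1 + localNorm R x h) ≤ R (x + h) - R x - fderiv ℝ R x h := by
  let a := localNorm R x h
  have ha : 0 ≤ a := localNorm_nonneg _ _ _
  have hmem : ∀ t ∈ Set.Icc (0 : ℝ) 1, x + t • h ∈ U := fun t ht =>
    hR.add_smul_mem hx (by simpa using hxh) ht.1 ht.2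
  have hder : ∀ t ∈ Set.Icc (0 : ℝ) 1,
      HasDerivAt (fun t : ℝ => R (x + t • h) - fderiv ℝ R x h * t - (a * t - Real.log (1 + a * t)))
        (fderiv ℝ R (x + t • h) h - fderiv ℝ R x h - a ^ 2 * t / (1 + a * t)) t := by
    intro t ht
    have hden : 1 + a * t ≠ 0 := by
      have := mul_nonneg ha ht.1
      positivity
    have hlin : ∀ c : ℝ, HasDerivAt (fun t : ℝ => c * t) c t := fun c => by
      simpa using (hasDerivAt_id t).const_mul c
    have hlog := (hlin a).sub (((hlin a).const_add 1).log hden)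
    refine (((hR.hasDerivAt_add_smul (hmem t ht)).sub (hlin _)).sub hlog).congr_deriv ?_
    field_simp
    ring
  have hmono := monotoneOn_of_deriv_nonneg (convex_Icc 0 1)
    (fun t ht => (hder t ht).continuousAt.continuousWithinAt)
    (fun t ht => (hder t (interior_subset ht)).differentiableAt.differentiableWithinAt)
    (fun t ht => by
      have ht' := interior_subset ht
      rw [(hder t ht').deriv, sub_nonneg]
      exact hR.sq_div_le_fderiv_sub hx ht'.1 (hmem t ht'))
  have hends := hmono (Set.left_mem_Icc.2 zero_le_one) (Set.right_mem_Icc.2 zero_le_one)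
    zero_le_one
  simp only [zero_smul, add_zero, mul_zero, sub_zero, Real.log_one, sub_self, one_smul,
    mul_one] at hends
  linarith

end IsSelfConcordantOn

/-! ### Follow the regularized leader -/

lemma neg_sq_le_sub_log {a r : ℝ} (ha : 0 ≤ a) (hr : r ≤ 1 / 4) :
    -(4 / 3 * r ^ 2) ≤ a - Real.log (1 + a) - r * a := by
  have hr' : 0 < 1 - r := by linarith
  have hupper : Real.log ((1 + a) * (1 - r)) ≤ (1 + a) * (1 - r) - 1 :=
    Real.log_le_sub_one_of_pos (by positivity)
  rw [Real.log_mul (by positivity) hr'.ne'] at hupper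
  have hlower : 1 - (1 - r)⁻¹ ≤ Real.log (1 - r) := Real.one_sub_inv_le_log_of_pos hr'
  have hinv : (1 - r)⁻¹ ≤ 1 + r + 4 / 3 * r ^ 2 := by
    rw [inv_le_iff_one_le_mul₀ hr']
    nlinarith [mul_nonneg (sq_nonneg r) (by linarith : (0 : ℝ) ≤ 1 / 4 - r)]
  linarith

namespace IsSelfConcordantOn

variable {n : ℕ} {U S : Set (Vec n)} {R : Vec n → ℝ}

lemma sub_log_le_of_isMinOn (hR : IsSelfConcordantOn U R) (hS : Convex ℝ S) (hSU : S ⊆ U)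
    {w x z : Vec n} (hx : x ∈ S) (hz : z ∈ S)
    (hmin : IsMinOn (fun z => inner ℝ w z + R z) S x) :
    localNorm R x (z - x) - Real.log (1 + localNorm R x (z - x)) ≤
      (inner ℝ w z + R z) - (inner ℝ w x + R x) := by
  have hd : HasFDerivAt (fun z => inner ℝ w z + R z) (innerSL ℝ w + fderiv ℝ R x) x :=
    (innerSL ℝ w).hasFDerivAt.add (hR.hasFDerivAt (hSU hx))
  have hfirst := hmin.localize.hasFDerivWithinAt_nonneg hd.hasFDerivWithinAt
    (sub_mem_posTangentConeAt_of_segment_subset (hS.segment_subset hx hz))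
  have hsecond := hR.localNorm_sub_log_le (hSU hx) (h := z - x) (by simpa using hSU hz)
  rw [add_sub_cancel] at hsecond
  simp only [add_apply, innerSL_apply_apply, inner_sub_right] at hfirst
  linarith

-- The induction of "be the leader": the value of the optimization problem of round `t` bounds the
-- cumulative loss of the iterates, up to a loss of `4/3 r²` per round.
lemma leader_le (hR : IsSelfConcordantOn U R) (hS : Convex ℝ S) (hSU : S ⊆ U) {T : ℕ}
    {g x : ℕ → Vec n} {η r : ℝ} (hr : r ≤ 1 / 4) (hx : ∀ t < T, x t ∈ S)
    (hmin : ∀ t < T,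
      IsMinOn (fun z => η * ∑ τ ∈ Finset.range t, inner ℝ (g τ) z + R z) S (x t))
    (hg : ∀ t < T, ∀ h, |η * inner ℝ (g t) h| ≤ r * localNorm R (x t) h) (hT : 0 < T) :
    ∀ t ≤ T, ∀ z ∈ S,
      R (x 0) + η * ∑ τ ∈ Finset.range t, inner ℝ (g τ) (x τ) - t * (4 / 3 * r ^ 2) ≤
        η * ∑ τ ∈ Finset.range t, inner ℝ (g τ) z + R z := by
  intro t
  induction t with
  | zero =>
    intro _ z hz
    simpa using hmin 0 hT hz
  | succ t ih =>
    intro ht z hz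
    have hlinear (z : Vec n) : η * ∑ τ ∈ Finset.range t, inner ℝ (g τ) z =
        inner ℝ (η • ∑ τ ∈ Finset.range t, g τ) z := by
      rw [real_inner_smul_left, sum_inner]
    have hmin_t := hmin t ht
    simp only [hlinear] at hmin_t
    have hgap := hR.sub_log_le_of_isMinOn hS hSU (hx t ht) hz hmin_t
    rw [← hlinear, ← hlinear] at hgap
    have hstep := (abs_le.1 (hg t ht (z - x t))).1
    rw [inner_sub_right] at hstep
    have hlog := neg_sq_le_sub_log (localNorm_nonneg R (x t) (z - x t)) hr
    have hprev := ih (Nat.le_of_succ_le ht) (x t) (hx t ht)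
    rw [Finset.sum_range_succ, Finset.sum_range_succ]
    push_cast
    linarith

lemma ftrl_regret_le (hR : IsSelfConcordantOn U R) (hS : Convex ℝ S) (hSU : S ⊆ U) {T : ℕ}
    {g x : ℕ → Vec n} {η r : ℝ} (hr : r ≤ 1 / 4) (hx : ∀ t < T, x t ∈ S)
    (hmin : ∀ t < T,
      IsMinOn (fun z => η * ∑ τ ∈ Finset.range t, inner ℝ (g τ) z + R z) S (x t))
    (hg : ∀ t < T, ∀ h, |η * inner ℝ (g t) h| ≤ r * localNorm R (x t) h) (hT : 0 < T)
    {z : Vec n} (hz : z ∈ S) :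
    η * ∑ τ ∈ Finset.range T, inner ℝ (g τ) (x τ - z) ≤ R z - R (x 0) + T * (4 / 3 * r ^ 2) := by
  have hleader := hR.leader_le hS hSU hr hx hmin hg hT T le_rfl z hz
  simp only [inner_sub_right, Finset.sum_sub_distrib]
  linarith

end IsSelfConcordantOn

/-! ### Cones -/

namespace IsClosedProperCone

variable {n : ℕ} {Ψ : Set (Vec n)} {x y h : Vec n}

lemma smul_mem_interior (hΨ : IsClosedProperCone Ψ) (hx : x ∈ interior Ψ) {c : ℝ} (hc : 0 < c) :
    c • x ∈ interior Ψ := by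
  have himage : c • x ∈ interior ((fun y => c • y) '' Ψ) :=
    (Homeomorph.smulOfNeZero (α := Vec n) c hc.ne').image_interior Ψ ▸ ⟨x, hx, rfl⟩
  exact interior_mono (Set.image_subset_iff.2 fun y hy => hΨ.smul_mem y hy c hc.le) himage

lemma add_mem_interior (hΨ : IsClosedProperCone Ψ) (hx : x ∈ interior Ψ) (hy : y ∈ interior Ψ) :
    x + y ∈ interior Ψ := by
  have hmid := hΨ.convex.interior hx hy (a := 1 / 2) (b := 1 / 2)
    (by norm_num) (by norm_num) (by norm_num)
  convert hΨ.smul_mem_interior hmid two_pos using 1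
  module

lemma mem_of_forall_add_smul_mem (hΨ : IsClosedProperCone Ψ)
    (hall : ∀ s : ℝ, 0 ≤ s → x + s • h ∈ Ψ) : h ∈ Ψ := by
  have hmem : ∀ᶠ s : ℝ in atTop, s⁻¹ • x + h ∈ Ψ := by
    filter_upwards [eventually_gt_atTop 0] with s hs
    have := hΨ.smul_mem _ (hall s hs.le) s⁻¹ (by positivity)
    rwa [smul_add, smul_smul, inv_mul_cancel₀ hs.ne', one_smul] at this
  have hlim : Tendsto (fun s : ℝ => s⁻¹ • x + h) atTop (𝓝 h) := by
    simpa using ((tendsto_inv_atTop_zero (𝕜 := ℝ)).smul_const x).add_const h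
  exact hΨ.isClosed.mem_of_tendsto hlim hmem

end IsClosedProperCone

/-! ### Normal barriers -/

namespace IsNormalBarrier

variable {n : ℕ} {Ψ : Set (Vec n)} {ν : ℝ} {R : Vec n → ℝ} {x y z h : Vec n}

lemma isSelfConcordantOn (hR : IsNormalBarrier Ψ ν R) : IsSelfConcordantOn (interior Ψ) R where
  isOpen := isOpen_interior
  convexOn := hR.convexOn
  contDiffOn := hR.contDiffOn
  third_le := hR.third_le

lemma contDiffAt (hR : IsNormalBarrier Ψ ν R) (hx : x ∈ interior Ψ) : ContDiffAt ℝ 3 R x :=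
  hR.isSelfConcordantOn.contDiffAt hx

lemma fderiv_sub_le (hR : IsNormalBarrier Ψ ν R) (hx : x ∈ interior Ψ) (hy : y ∈ interior Ψ) :
    fderiv ℝ R x (y - x) ≤ R y - R x :=
  fderiv_sub_le_of_convexOn hR.convexOn (hR.isSelfConcordantOn.hasFDerivAt hx) hx hy

lemma subset_interior_of_bddAbove (hR : IsNormalBarrier Ψ ν R) {A : Set (Vec n)}
    (hA : IsPreconnected A) (hne : (A ∩ interior Ψ).Nonempty)
    (hbdd : BddAbove (R '' (A ∩ interior Ψ))) : A ⊆ interior Ψ := by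
  obtain ⟨M, hM⟩ := hbdd
  have hclosed : A ∩ closure (A ∩ interior Ψ) ⊆ interior Ψ := by
    rintro w ⟨-, hw⟩
    by_contra hwi
    have hfrontier : w ∈ frontier Ψ :=
      ⟨closure_mono (Set.inter_subset_right.trans interior_subset) hw, hwi⟩
    have hlarge := (hR.tendsto_atTop w hfrontier).eventually_gt_atTop M
    obtain ⟨v, hv, hvA, hvi⟩ := mem_closure_iff_nhds.1 hw _ (eventually_nhdsWithin_iff.1 hlarge)
    exact (hv hvi).not_ge (hM ⟨v, ⟨hvA, hvi⟩, rfl⟩)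
  by_contra hsub
  obtain ⟨w, hwA, hwi⟩ := Set.not_subset.1 hsub
  obtain ⟨v, hvA, hvi, hv⟩ := hA (interior Ψ) (closure (A ∩ interior Ψ))ᶜ isOpen_interior
    isClosed_closure.isOpen_compl
    (fun v hv => or_iff_not_imp_right.2 fun hvc => hclosed ⟨hv, not_not.1 hvc⟩) hne
    ⟨w, hwA, fun hwc => hwi (hclosed ⟨hwA, hwc⟩)⟩
  exact hv (subset_closure ⟨hvA, hvi⟩)

-- The Dikin ellipsoid.
lemma add_mem_interior (hR : IsNormalBarrier Ψ ν R) (hx : x ∈ interior Ψ)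
    (hh : localNorm R x h < 1) : x + h ∈ interior Ψ := by
  let a := localNorm R x h
  have ha : 0 ≤ a := localNorm_nonneg _ _ _
  have ha' : 0 < 1 - a := sub_pos.2 hh
  have hbound : ∀ r ∈ Set.Icc (0 : ℝ) 1, x + r • h ∈ interior Ψ →
      R (x + r • h) ≤ R x + √ν * (a / (1 - a)) := by
    intro r hr hri
    have hlocal : localNorm R (x + r • h) h ≤ a / (1 - a) := by
      rw [le_div_iff₀ ha']
      refine le_trans ?_ (hR.isSelfConcordantOn.localNorm_mul_le hx hr.1 hri)
      have : r * a ≤ a := mul_le_of_le_one_left ha hr.2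
      exact mul_le_mul_of_nonneg_left (by linarith) (localNorm_nonneg _ _ _)
    have hgrad : r * fderiv ℝ R (x + r • h) h ≤ √ν * (a / (1 - a)) :=
      calc r * fderiv ℝ R (x + r • h) h ≤ r * (√ν * (a / (1 - a))) := by
            refine mul_le_mul_of_nonneg_left ?_ hr.1
            exact (le_abs_self _).trans ((hR.grad_le _ hri h).trans (by gcongr))
        _ ≤ √ν * (a / (1 - a)) := mul_le_of_le_one_left (by positivity) hr.2
    have hconv := hR.fderiv_sub_le hri hx
    rw [sub_add_cancel_left, map_neg, map_smul, smul_eq_mul] at hconv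
    linarith
  have hsub := hR.subset_interior_of_bddAbove (A := segment ℝ x (x + h))
    (convex_segment _ _).isPreconnected ⟨x, left_mem_segment _ _ _, hx⟩
    ⟨R x + √ν * (a / (1 - a)), by
      rintro _ ⟨w, ⟨hw, hwi⟩, rfl⟩
      rw [segment_eq_image', add_sub_cancel_left] at hw
      obtain ⟨r, hr, rfl⟩ := hw
      exact hbound r hr hwi⟩
  exact hsub (right_mem_segment _ _ _)

-- A degenerate direction would, by the Dikin ellipsoid, span a line inside the pointed cone.
lemma localNorm_pos (hR : IsNormalBarrier Ψ ν R) (hx : x ∈ interior Ψ) (hh : h ≠ 0) :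
    0 < localNorm R x h := by
  refine (localNorm_nonneg _ _ _).lt_of_ne' fun h0 => hh ?_
  have hline (s : ℝ) : x + s • h ∈ Ψ :=
    interior_subset (hR.add_mem_interior hx (by simp [localNorm_smul, h0]))
  exact hR.cone.pointed h (hR.cone.mem_of_forall_add_smul_mem fun s _ => hline s)
    (hR.cone.mem_of_forall_add_smul_mem fun s _ => by simpa using hline (-s))

lemma secondDeriv_pos (hR : IsNormalBarrier Ψ ν R) (hx : x ∈ interior Ψ) (hh : h ≠ 0) :
    0 < secondDeriv R x h h := by
  rw [← hR.isSelfConcordantOn.localNorm_sq hx]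
  exact pow_pos (hR.localNorm_pos hx hh) 2

lemma fderiv_self (hR : IsNormalBarrier Ψ ν R) (hx : x ∈ interior Ψ) :
    fderiv ℝ R x x = -ν := by
  have hline : HasDerivAt (fun s : ℝ => R (x + s • x)) (fderiv ℝ R x x) 0 := by
    simpa using hR.isSelfConcordantOn.hasDerivAt_add_smul (x := x) (h := x) (s := 0)
      (by simpa using hx)
  have hlog : HasDerivAt (fun s : ℝ => R x - ν * Real.log (1 + s)) (-ν) 0 := by
    simpa using
      ((((hasDerivAt_id (0 : ℝ)).const_add 1).log (by simp)).const_mul ν).const_sub (R x)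
  refine hline.unique (hlog.congr_of_eventuallyEq ?_)
  filter_upwards [lt_mem_nhds (show (-1 : ℝ) < 0 by norm_num)] with s hs
  rw [← hR.log_homogeneous x hx (1 + s) (by linarith), add_smul, one_smul]

lemma fderiv_smul (hR : IsNormalBarrier Ψ ν R) (hx : x ∈ interior Ψ) {c : ℝ} (hc : 0 < c)
    (h : Vec n) : fderiv ℝ R (c • x) h = c⁻¹ * fderiv ℝ R x h := by
  have hscaled : HasFDerivAt (fun y => R (c • y)) (fderiv ℝ R (c • x) ∘L (c • .id ℝ (Vec n))) x :=
    (hR.isSelfConcordantOn.hasFDerivAt (hR.cone.smul_mem_interior hx hc)).comp x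
      ((hasFDerivAt_id x).const_smul c)
  have hshift : HasFDerivAt (fun y => R y - ν * Real.log c) (fderiv ℝ R x) x :=
    (hR.isSelfConcordantOn.hasFDerivAt hx).sub_const _
  have heq : (fun y => R (c • y)) =ᶠ[𝓝 x] fun y => R y - ν * Real.log c := by
    filter_upwards [isOpen_interior.mem_nhds hx] with y hy
    exact hR.log_homogeneous y hy c hc
  have := congrArg (· h) (hscaled.unique (hshift.congr_of_eventuallyEq heq))
  simp only [ContinuousLinearMap.comp_apply, smul_apply, ContinuousLinearMap.id_apply, map_smul,
    smul_eq_mul] at this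
  rw [← this, inv_mul_cancel_left₀ hc.ne']

lemma secondDeriv_self (hR : IsNormalBarrier Ψ ν R) (hx : x ∈ interior Ψ) (h : Vec n) :
    secondDeriv R x x h = -fderiv ℝ R x h := by
  have hline : HasDerivAt (fun s : ℝ => fderiv ℝ R (x + s • x) h) (secondDeriv R x x h) 0 := by
    simpa using hasDerivAt_fderiv_add_smul (f := R) (x := x) (h := x) (s := 0)
      (by simpa using (hR.contDiffAt hx).of_le (by norm_num)) h
  have hinv : HasDerivAt (fun s : ℝ => (1 + s)⁻¹ * fderiv ℝ R x h) (-fderiv ℝ R x h) 0 := by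
    simpa using (((hasDerivAt_id (0 : ℝ)).const_add 1).inv (by simp)).mul_const (fderiv ℝ R x h)
  refine hline.unique (hinv.congr_of_eventuallyEq ?_)
  filter_upwards [lt_mem_nhds (show (-1 : ℝ) < 0 by norm_num)] with s hs
  rw [← hR.fderiv_smul hx (by linarith), add_smul, one_smul]

lemma fderiv_nonpos (hR : IsNormalBarrier Ψ ν R) (hx : x ∈ interior Ψ) (hy : y ∈ interior Ψ) :
    fderiv ℝ R x y ≤ 0 := by
  have hlinear : ∀ t : ℝ, 1 ≤ t → t * fderiv ℝ R x y ≤ R y - R x := by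
    intro t ht
    have ht0 : 0 < t := by linarith
    have hconv := hR.fderiv_sub_le hx (hR.cone.smul_mem_interior hy ht0)
    rw [map_sub, map_smul, smul_eq_mul, hR.fderiv_self hx, hR.log_homogeneous y hy t ht0] at hconv
    have := mul_nonneg (zero_le_one.trans hR.one_le) (Real.log_nonneg ht)
    linarith [hR.one_le]
  by_contra! hpos
  obtain ⟨t, hlarge, ht⟩ := (((tendsto_id.atTop_mul_const hpos).eventually_gt_atTop
    (R y - R x)).and (eventually_ge_atTop 1)).exists
  exact hlarge.not_ge (hlinear t ht)

lemma add_le (hR : IsNormalBarrier Ψ ν R) (hx : x ∈ interior Ψ) (hy : y ∈ interior Ψ) :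
    R (x + y) ≤ R x := by
  have hxy := hR.cone.add_mem_interior hx hy
  have hconv := hR.fderiv_sub_le hxy hx
  rw [sub_add_cancel_left, map_neg] at hconv
  linarith [hR.fderiv_nonpos hxy hy]

-- Along the ray `x + t y` the derivative of `R` stays nonpositive, while self-concordance makes it
-- grow by almost `localNorm R x y`.
lemma localNorm_le_neg_fderiv (hR : IsNormalBarrier Ψ ν R) (hx : x ∈ interior Ψ)
    (hy : y ∈ interior Ψ) : localNorm R x y ≤ -fderiv ℝ R x y := by
  let a := localNorm R x y
  let b := -fderiv ℝ R x y
  have ha : 0 ≤ a := localNorm_nonneg _ _ _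
  have hray : ∀ t : ℝ, 0 < t → t * (a * (a - b)) ≤ b := by
    intro t ht
    have hxt := hR.cone.add_mem_interior hx (hR.cone.smul_mem_interior hy ht)
    have hgrow : a ^ 2 * t / (1 + a * t) ≤ b :=
      (hR.isSelfConcordantOn.sq_div_le_fderiv_sub hx ht.le hxt).trans
        (by linarith [hR.fderiv_nonpos hxt hy])
    rw [div_le_iff₀ (by positivity)] at hgrow
    linarith
  by_contra! hlt
  have hb : 0 ≤ b := neg_nonneg.2 (hR.fderiv_nonpos hx hy)
  have hpos : 0 < a * (a - b) := mul_pos (hb.trans_lt hlt) (sub_pos.2 hlt)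
  obtain ⟨t, hlarge, ht⟩ := (((tendsto_id.atTop_mul_const hpos).eventually_gt_atTop b).and
    (eventually_gt_atTop 0)).exists
  exact hlarge.not_ge (hray t ht)

lemma localNorm_sub_le (hR : IsNormalBarrier Ψ ν R) (hx : x ∈ interior Ψ) (hy : y ∈ interior Ψ)
    (hgrad : 0 ≤ fderiv ℝ R x (y - x)) : localNorm R x (y - x) ≤ ν := by
  have hν := hR.one_le
  have hsq : localNorm R x (y - x) ^ 2 = localNorm R x y ^ 2 + 2 * fderiv ℝ R x y + ν := by
    have hexpand : secondDeriv R x (y - x) (y - x) = secondDeriv R x y y - secondDeriv R x y x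
        - (secondDeriv R x x y - secondDeriv R x x x) := by
      simp only [secondDeriv, map_sub, sub_apply]
      ring
    rw [hR.isSelfConcordantOn.localNorm_sq hx, hR.isSelfConcordantOn.localNorm_sq hx, hexpand,
      secondDeriv_comm ((hR.contDiffAt hx).of_le (by norm_num)) y x, hR.secondDeriv_self hx,
      hR.secondDeriv_self hx, hR.fderiv_self hx]
    ring
  have hle := hR.localNorm_le_neg_fderiv hx hy
  have hnonneg := localNorm_nonneg R x y
  rw [map_sub, hR.fderiv_self hx] at hgrad
  refine (abs_le_of_sq_le_sq' ?_ (by linarith)).2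
  rw [hsq]
  nlinarith

lemma localNorm_sub_le_div (hR : IsNormalBarrier Ψ ν R) (hx : x ∈ interior Ψ)
    (hz : z ∈ interior Ψ) {s : ℝ} (hs : 0 < s) (hs1 : s ≤ 1)
    (hw : x + s • (x - z) ∈ interior Ψ) : localNorm R x (z - x) ≤ ν / s := by
  rcases le_total 0 (fderiv ℝ R x (z - x)) with hgrad | hgrad
  · exact (hR.localNorm_sub_le hx hz hgrad).trans
      (le_div_self (zero_le_one.trans hR.one_le) hs hs1)
  · have hdir : x + s • (x - z) - x = (-s) • (z - x) := by module
    have hle := hR.localNorm_sub_le hx hw (by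
      rw [hdir, map_smul, smul_eq_mul]
      exact mul_nonneg_of_nonpos_of_nonpos (neg_nonpos.2 hs.le) hgrad)
    rwa [hdir, localNorm_smul, abs_neg, abs_of_pos hs, mul_comm, ← le_div_iff₀ hs] at hle

lemma sub_le_mul_log (hR : IsNormalBarrier Ψ ν R) (hx : x ∈ interior Ψ) {κ : ℝ} (hκ : 0 < κ)
    (hz : z - κ • x ∈ interior Ψ) : R z - R x ≤ ν * Real.log (1 / κ) := by
  have hle := hR.add_le (hR.cone.smul_mem_interior hx hκ) hz
  rw [add_sub_cancel, hR.log_homogeneous x hx κ hκ] at hle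
  rw [one_div, Real.log_inv]
  linarith

end IsNormalBarrier

/-! ### Powers of positive definite matrices -/

section PosDef

variable {ι : Type*} [Fintype ι] [DecidableEq ι] {M : Matrix ι ι ℝ}

lemma spectrum_subset_Ioi_of_posDef (hM : M.PosDef) : spectrum ℝ M ⊆ Set.Ioi 0 := by
  rw [hM.isHermitian.spectrum_real_eq_range_eigenvalues]
  rintro _ ⟨i, rfl⟩
  exact hM.eigenvalues_pos i

lemma continuousOn_rpow_const_Ioi (p : ℝ) : ContinuousOn (fun s : ℝ => s ^ p) (Set.Ioi 0) :=
  continuousOn_id.rpow_const fun _ hs => Or.inl (ne_of_gt hs)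

lemma cfc_rpow_mul_cfc_rpow (hM : M.PosDef) (p q : ℝ) :
    cfc (fun s : ℝ => s ^ p) M * cfc (fun s : ℝ => s ^ q) M =
      cfc (fun s : ℝ => s ^ (p + q)) M := by
  have hcont (r : ℝ) := (continuousOn_rpow_const_Ioi r).mono (spectrum_subset_Ioi_of_posDef hM)
  rw [← cfc_mul _ _ _ (hcont p) (hcont q)]
  exact cfc_congr fun s hs => (Real.rpow_add (spectrum_subset_Ioi_of_posDef hM hs) p q).symm

lemma cfc_rpow_neg_mul_cfc_rpow (hM : M.PosDef) (p : ℝ) :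
    cfc (fun s : ℝ => s ^ (-p)) M * cfc (fun s : ℝ => s ^ p) M = 1 := by
  have : IsSelfAdjoint M := hM.isHermitian
  simp only [cfc_rpow_mul_cfc_rpow hM, neg_add_cancel, Real.rpow_zero]
  exact cfc_const_one ℝ M

end PosDef

/-! ### The scaling matrix -/

section Scaling

variable {n : ℕ}

lemma mulVecE_mulVecE (A B : Matrix (Fin n) (Fin n) ℝ) (z : Vec n) :
    mulVecE A (mulVecE B z) = mulVecE (A * B) z := by
  simp [mulVecE, Matrix.mulVec_mulVec]

lemma mulVecE_one (z : Vec n) : mulVecE 1 z = z := by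
  simp [mulVecE]

lemma inner_mulVecE_comm {A : Matrix (Fin n) (Fin n) ℝ} (hA : Aᵀ = A) (x y : Vec n) :
    inner ℝ (mulVecE A x) y = inner ℝ x (mulVecE A y) := by
  simp only [mulVecE, EuclideanSpace.inner_eq_star_dotProduct, star_trivial]
  rw [Matrix.dotProduct_mulVec, ← Matrix.mulVec_transpose, hA]

lemma scaling_transpose (R : Vec n → ℝ) (x : Vec n) : (scaling R x)ᵀ = scaling R x := by
  have h : IsSelfAdjoint (scaling R x) := cfc_predicate _ _
  rwa [← Matrix.conjTranspose_eq_transpose_of_trivial]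

lemma scaling_inv_transpose (R : Vec n → ℝ) (x : Vec n) :
    (scaling R x)⁻¹ᵀ = (scaling R x)⁻¹ := by
  rw [Matrix.transpose_nonsing_inv, scaling_transpose]

namespace IsNormalBarrier

variable {Ψ : Set (Vec n)} {ν : ℝ} {R : Vec n → ℝ} {x : Vec n}

lemma posDef_hessian (hR : IsNormalBarrier Ψ ν R) (hx : x ∈ interior Ψ) :
    (hessian R x).PosDef := by
  refine .of_dotProduct_mulVec_pos ?_ fun v hv => ?_
  · ext i j
    simp only [Matrix.conjTranspose_apply, hessian_apply, star_trivial]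
    exact secondDeriv_comm ((hR.contDiffAt hx).of_le (by norm_num)) _ _
  · have hpos := hR.secondDeriv_pos hx (h := WithLp.toLp 2 v) (by simpa using hv)
    rw [← inner_mulVecE_hessian, EuclideanSpace.inner_eq_star_dotProduct] at hpos
    simpa [mulVecE, dotProduct_comm] using hpos

lemma scaling_mul_cfc_rpow (hR : IsNormalBarrier Ψ ν R) (hx : x ∈ interior Ψ) :
    scaling R x * cfc (fun s : ℝ => s ^ (1 / 2 : ℝ)) (hessian R x) = 1 :=
  cfc_rpow_neg_mul_cfc_rpow (hR.posDef_hessian hx) _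

lemma scaling_inv (hR : IsNormalBarrier Ψ ν R) (hx : x ∈ interior Ψ) :
    (scaling R x)⁻¹ = cfc (fun s : ℝ => s ^ (1 / 2 : ℝ)) (hessian R x) :=
  Matrix.inv_eq_right_inv (hR.scaling_mul_cfc_rpow hx)

lemma scaling_mul_inv (hR : IsNormalBarrier Ψ ν R) (hx : x ∈ interior Ψ) :
    scaling R x * (scaling R x)⁻¹ = 1 := by
  rw [hR.scaling_inv hx, hR.scaling_mul_cfc_rpow hx]

lemma scaling_inv_mul (hR : IsNormalBarrier Ψ ν R) (hx : x ∈ interior Ψ) :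
    (scaling R x)⁻¹ * scaling R x = 1 :=
  mul_eq_one_comm.1 (hR.scaling_mul_inv hx)

lemma scaling_inv_mul_scaling_inv (hR : IsNormalBarrier Ψ ν R) (hx : x ∈ interior Ψ) :
    (scaling R x)⁻¹ * (scaling R x)⁻¹ = hessian R x := by
  have : IsSelfAdjoint (hessian R x) := (hR.posDef_hessian hx).isHermitian
  simp only [hR.scaling_inv hx, cfc_rpow_mul_cfc_rpow (hR.posDef_hessian hx), add_halves,
    Real.rpow_one]
  exact cfc_id' ℝ (hessian R x)

lemma norm_scaling_inv (hR : IsNormalBarrier Ψ ν R) (hx : x ∈ interior Ψ) (h : Vec n) :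
    ‖mulVecE (scaling R x)⁻¹ h‖ = localNorm R x h := by
  rw [localNorm, ← hR.scaling_inv_mul_scaling_inv hx, ← mulVecE_mulVecE,
    ← inner_mulVecE_comm (scaling_inv_transpose R x), real_inner_self_eq_norm_sq,
    Real.sqrt_sq (norm_nonneg _)]

lemma localNorm_scaling (hR : IsNormalBarrier Ψ ν R) (hx : x ∈ interior Ψ) (u : Vec n) :
    localNorm R x (mulVecE (scaling R x) u) = ‖u‖ := by
  rw [← hR.norm_scaling_inv hx, mulVecE_mulVecE, hR.scaling_inv_mul hx, mulVecE_one]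

lemma continuousOn_hessian (hR : IsNormalBarrier Ψ ν R) :
    ContinuousOn (hessian R) (interior Ψ) := by
  refine continuousOn_pi.2 fun i => continuousOn_pi.2 fun j => ?_
  simp only [hessian_apply, secondDeriv]
  have hfderiv : ContinuousOn (fderiv ℝ (fderiv ℝ R)) (interior Ψ) := fun x hx =>
    (hR.isSelfConcordantOn.contDiffAt_fderiv_fderiv hx).continuousAt.continuousWithinAt
  exact (hfderiv.clm_apply continuousOn_const).clm_apply continuousOn_const

lemma continuousOn_scaling (hR : IsNormalBarrier Ψ ν R) :
    ContinuousOn (scaling R) (interior Ψ) := by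
  let _ := Matrix.instL2OpNormedRing (n := Fin n) (𝕜 := ℝ)
  let _ := Matrix.instL2OpNormedAlgebra (n := Fin n) (𝕜 := ℝ)
  have : CStarRing (Matrix (Fin n) (Fin n) ℝ) := Matrix.instCStarRing
  have : CompleteSpace (Matrix (Fin n) (Fin n) ℝ) := FiniteDimensional.complete ℝ _
  exact ContinuousOn.cfc_of_mem_nhdsSet (s := Set.Ioi (0 : ℝ)) _
    (isOpen_Ioi.mem_nhdsSet.2 <| Set.iUnion₂_subset fun x hx =>
      spectrum_subset_Ioi_of_posDef (hR.posDef_hessian hx))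
    hR.continuousOn_hessian (fun x hx => (hR.posDef_hessian hx).isHermitian)
    (continuousOn_rpow_const_Ioi _)

lemma continuousOn_scaling_inv (hR : IsNormalBarrier Ψ ν R) :
    ContinuousOn (fun x => (scaling R x)⁻¹) (interior Ψ) := by
  have hmul : ContinuousOn (fun x => hessian R x * scaling R x) (interior Ψ) := fun x hx =>
    (hR.continuousOn_hessian x hx).mul (hR.continuousOn_scaling x hx)
  refine hmul.congr fun x hx => ?_
  dsimp only
  rw [← hR.scaling_inv_mul_scaling_inv hx, mul_assoc, hR.scaling_inv_mul hx, mul_one]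

end IsNormalBarrier

end Scaling

/-! ### Moments of the uniform measure on a sphere -/

section Sphere

variable {E : Type*} [NormedAddCommGroup E] [InnerProductSpace ℝ E]

/-- The map induced on the unit sphere by a linear isometry, used to express the rotation
invariance of the uniform measure. -/
def sphereMap (L : E ≃ₗᵢ[ℝ] E) (s : Metric.sphere (0 : E) 1) : Metric.sphere (0 : E) 1 :=
  ⟨L s, by simp⟩

open scoped Pointwise in
lemma Ioo_smul_sphereMap_preimage (L : E ≃ₗᵢ[ℝ] E) (s : Set (Metric.sphere (0 : E) 1)) :
    Set.Ioo (0 : ℝ) 1 • (Subtype.val '' (sphereMap L ⁻¹' s) : Set E) =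
      L ⁻¹' (Set.Ioo (0 : ℝ) 1 • (Subtype.val '' s)) := by
  ext z
  simp only [Set.mem_smul, Set.mem_image, Set.mem_preimage]
  constructor
  · rintro ⟨a, ha, _, ⟨w, hw, rfl⟩, rfl⟩
    exact ⟨a, ha, _, ⟨sphereMap L w, hw, rfl⟩, by simp [sphereMap]⟩
  · rintro ⟨a, ha, _, ⟨w, hw, rfl⟩, hz⟩
    refine ⟨a, ha, L.symm w, ⟨⟨L.symm w, by simp⟩, ?_, rfl⟩, L.injective (by simp [hz])⟩
    simpa [sphereMap] using hw

variable [MeasurableSpace E] [BorelSpace E]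

lemma measurable_sphereMap (L : E ≃ₗᵢ[ℝ] E) : Measurable (sphereMap L) :=
  (L.continuous.measurable.comp measurable_subtype_coe).subtype_mk

variable [FiniteDimensional ℝ E]

lemma map_sphereMap_toSphere (L : E ≃ₗᵢ[ℝ] E) :
    (volume : Measure E).toSphere.map (sphereMap L) = (volume : Measure E).toSphere := by
  ext s hs
  rw [Measure.map_apply (measurable_sphereMap L) hs, Measure.toSphere_apply' _ hs,
    Measure.toSphere_apply' _ (measurable_sphereMap L hs), Ioo_smul_sphereMap_preimage]
  congr 1
  exact MeasurePreserving.measure_preimage_equiv (f := L.toMeasurableEquiv) L.measurePreserving _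

lemma map_sphereMap_uniformSphere (L : E ≃ₗᵢ[ℝ] E) :
    (uniformSphere E).map (sphereMap L) = uniformSphere E := by
  rw [uniformSphere, Measure.map_smul, map_sphereMap_toSphere]

instance [Nontrivial E] : IsProbabilityMeasure (uniformSphere E) where
  measure_univ := by
    rw [uniformSphere, Measure.smul_apply, smul_eq_mul]
    refine ENNReal.inv_mul_cancel ?_ (measure_ne_top _ _)
    exact Measure.measure_univ_eq_zero.not.2 (Measure.toSphere_ne_zero _)

lemma integral_uniformSphere_comp (L : E ≃ₗᵢ[ℝ] E) {g : E → ℝ} (hg : Continuous g) :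
    ∫ s, g (L s) ∂uniformSphere E = ∫ s, g s ∂uniformSphere E := by
  conv_rhs => rw [← map_sphereMap_uniformSphere L]
  exact (integral_map (measurable_sphereMap L).aemeasurable
    (hg.comp continuous_subtype_val).aestronglyMeasurable).symm

lemma integrable_uniformSphere [Nontrivial E] {g : E → ℝ} (hg : Continuous g) :
    Integrable (fun s : Metric.sphere (0 : E) 1 => g s) (uniformSphere E) := by
  have : CompactSpace (Metric.sphere (0 : E) 1) :=
    isCompact_iff_compactSpace.1 (isCompact_sphere _ _)
  exact (hg.comp continuous_subtype_val).integrable_of_hasCompactSupport (.of_compactSpace _)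

lemma integral_inner_uniformSphere (w : E) : ∫ s, inner ℝ w (s : E) ∂uniformSphere E = 0 := by
  have hneg := integral_uniformSphere_comp (LinearIsometryEquiv.neg ℝ (E := E))
    (g := fun z => inner ℝ w z) (by fun_prop)
  simp only [LinearIsometryEquiv.coe_neg, inner_neg_right, integral_neg] at hneg
  linarith

lemma integral_inner_sq_uniformSphere_congr {v w : E} (h : ‖v‖ = ‖w‖) :
    ∫ s, (inner ℝ v (s : E)) ^ 2 ∂uniformSphere E =
      ∫ s, (inner ℝ w (s : E)) ^ 2 ∂uniformSphere E := by
  set L : E ≃ₗᵢ[ℝ] E := (ℝ ∙ (v - w))ᗮ.reflection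
  have hL : L v = w := Submodule.reflection_sub h
  rw [← integral_uniformSphere_comp L (g := fun z => (inner ℝ w z) ^ 2) (by fun_prop), ← hL]
  simp only [LinearIsometryEquiv.inner_map_map]

lemma sum_integral_inner_sq_uniformSphere [Nontrivial E] {ι : Type*} [Fintype ι]
    (b : OrthonormalBasis ι ℝ E) :
    ∑ i, ∫ s, (inner ℝ (b i) (s : E)) ^ 2 ∂uniformSphere E = 1 := by
  rw [← integral_finsetSum _ fun i _ =>
    integrable_uniformSphere (g := fun z : E => (inner ℝ (b i) z) ^ 2) (by fun_prop)]
  have hone (s : Metric.sphere (0 : E) 1) : ∑ i, (inner ℝ (b i) (s : E)) ^ 2 = 1 := by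
    simpa using b.sum_sq_norm_inner_right (s : E)
  simp [hone]

lemma integral_inner_sq_uniformSphere [Nontrivial E] (w : E) :
    ∫ s, (inner ℝ w (s : E)) ^ 2 ∂uniformSphere E = ‖w‖ ^ 2 / Module.finrank ℝ E := by
  set b := stdOrthonormalBasis ℝ E
  have hn : (Module.finrank ℝ E : ℝ) ≠ 0 := by exact_mod_cast Module.finrank_pos.ne'
  have heq (i) : ∫ s, (inner ℝ w (s : E)) ^ 2 ∂uniformSphere E =
      ‖w‖ ^ 2 * ∫ s, (inner ℝ (b i) (s : E)) ^ 2 ∂uniformSphere E := by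
    rw [integral_inner_sq_uniformSphere_congr (w := ‖w‖ • b i) (by simp [norm_smul])]
    simp only [real_inner_smul_left, mul_pow, integral_const_mul]
  have hsum : ∑ _i : Fin (Module.finrank ℝ E),
      ∫ s, (inner ℝ w (s : E)) ^ 2 ∂uniformSphere E = ‖w‖ ^ 2 := by
    rw [Finset.sum_congr rfl fun i _ => heq i, ← Finset.mul_sum,
      sum_integral_inner_sq_uniformSphere, mul_one]
  rw [Finset.sum_const, Finset.card_univ, Fintype.card_fin, nsmul_eq_mul] at hsum
  rw [eq_div_iff hn, mul_comm, hsum]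

lemma integral_inner_mul_inner_uniformSphere [Nontrivial E] (v w : E) :
    ∫ s, inner ℝ v (s : E) * inner ℝ w (s : E) ∂uniformSphere E =
      inner ℝ v w / Module.finrank ℝ E := by
  have polarization (s : Metric.sphere (0 : E) 1) :
      inner ℝ v (s : E) * inner ℝ w (s : E) =
        1 / 4 * ((inner ℝ (v + w) (s : E)) ^ 2 - (inner ℝ (v - w) (s : E)) ^ 2) := by
    rw [inner_add_left, inner_sub_left]
    ring
  simp only [polarization]
  rw [integral_const_mul, integral_sub
    (integrable_uniformSphere (g := fun z : E => (inner ℝ (v + w) z) ^ 2) (by fun_prop))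
    (integrable_uniformSphere (g := fun z : E => (inner ℝ (v - w) z) ^ 2) (by fun_prop)),
    integral_inner_sq_uniformSphere, integral_inner_sq_uniformSphere, norm_add_sq_real,
    norm_sub_sq_real]
  ring

end Sphere

section Perp

lemma measurable_coe_sphere {n : ℕ} (v : Vec n) :
    Measurable fun s : Metric.sphere (0 : ((ℝ ∙ v)ᗮ : Submodule ℝ (Vec n))) 1 => (s.1 : Vec n) :=
  measurable_subtype_coe.comp measurable_subtype_coe

lemma uniformPerp_compl_eq_zero {n : ℕ} (v : Vec n) :
    uniformPerp v ({z | ‖z‖ = 1 ∧ inner ℝ v z = 0} : Set (Vec n))ᶜ = 0 := by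
  have hmeas : MeasurableSet ({z | ‖z‖ = 1 ∧ inner ℝ v z = 0} : Set (Vec n)) :=
    (measurableSet_eq_fun (by fun_prop) (by fun_prop)).inter
      (measurableSet_eq_fun (by fun_prop) (by fun_prop))
  rw [uniformPerp, Measure.map_apply (measurable_coe_sphere v) hmeas.compl]
  refine (congrArg _ (Set.eq_empty_iff_forall_notMem.2 fun s => ?_)).trans measure_empty
  exact not_not.2 ⟨mem_sphere_zero_iff_norm.1 s.2,
    Submodule.mem_orthogonal_singleton_iff_inner_right.1 s.1.2⟩

lemma integral_uniformPerp {n : ℕ} (v : Vec n) {g : Vec n → ℝ} (hg : Continuous g) :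
    ∫ z, g z ∂uniformPerp v =
      ∫ s, g (s.1 : Vec n) ∂uniformSphere ((ℝ ∙ v)ᗮ : Submodule ℝ (Vec n)) := by
  rw [uniformPerp, integral_map (measurable_coe_sphere v).aemeasurable hg.aestronglyMeasurable]

lemma inner_coe_orthogonal {n : ℕ} (v w : Vec n) (z : ((ℝ ∙ v)ᗮ : Submodule ℝ (Vec n))) :
    inner ℝ w (z : Vec n) = inner ℝ ((ℝ ∙ v)ᗮ.orthogonalProjectionOnto w) z :=
  (Submodule.inner_orthogonalProjectionOnto_eq_of_mem_right z w).symm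

lemma integral_inner_uniformPerp {n : ℕ} (v w : Vec n) :
    ∫ z, inner ℝ w z ∂uniformPerp v = 0 := by
  rw [integral_uniformPerp v (by fun_prop)]
  simp only [inner_coe_orthogonal]
  exact integral_inner_uniformSphere _

variable {d : ℕ} {v : Vec (d + 1)}

lemma finrank_orthogonal_span (hv : v ≠ 0) :
    Module.finrank ℝ ((ℝ ∙ v)ᗮ : Submodule ℝ (Vec (d + 1))) = d := by
  have hsum := (ℝ ∙ v).finrank_add_finrank_orthogonal
  rw [finrank_span_singleton hv, finrank_euclideanSpace_fin] at hsum
  omega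

lemma nontrivial_orthogonal_span (hd : 1 ≤ d) (hv : v ≠ 0) :
    Nontrivial ((ℝ ∙ v)ᗮ : Submodule ℝ (Vec (d + 1))) :=
  Module.nontrivial_of_finrank_pos (R := ℝ) (by rw [finrank_orthogonal_span hv]; omega)

lemma isProbabilityMeasure_uniformPerp (hd : 1 ≤ d) (hv : v ≠ 0) :
    IsProbabilityMeasure (uniformPerp v) := by
  have := nontrivial_orthogonal_span hd hv
  exact Measure.isProbabilityMeasure_map (measurable_coe_sphere v).aemeasurable

lemma integrable_uniformPerp (hd : 1 ≤ d) (hv : v ≠ 0) {g : Vec (d + 1) → ℝ}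
    (hg : Continuous g) : Integrable g (uniformPerp v) := by
  have := nontrivial_orthogonal_span hd hv
  rw [uniformPerp, integrable_map_measure hg.aestronglyMeasurable
    (measurable_coe_sphere v).aemeasurable]
  exact integrable_uniformSphere (E := ((ℝ ∙ v)ᗮ : Submodule ℝ (Vec (d + 1))))
    (g := fun z => g z) (hg.comp continuous_subtype_val)

lemma integral_inner_mul_inner_uniformPerp (hd : 1 ≤ d) (hv : v ≠ 0) (a : Vec (d + 1))
    {b : Vec (d + 1)} (hb : inner ℝ v b = 0) :
    ∫ z, inner ℝ a z * inner ℝ b z ∂uniformPerp v = inner ℝ a b / d := by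
  have := nontrivial_orthogonal_span hd hv
  rw [integral_uniformPerp v (g := fun z => inner ℝ a z * inner ℝ b z) (by fun_prop)]
  simp only [inner_coe_orthogonal]
  rw [integral_inner_mul_inner_uniformSphere, finrank_orthogonal_span hv]
  lift b to ((ℝ ∙ v)ᗮ : Submodule ℝ (Vec (d + 1))) using
    Submodule.mem_orthogonal_singleton_iff_inner_right.2 hb
  rw [Submodule.orthogonalProjectionOnto_mem_subspace_eq_self, inner_coe_orthogonal]

lemma integral_affine_mul_inner_uniformPerp (hd : 1 ≤ d) (hv : v ≠ 0) (c : ℝ)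
    (a : Vec (d + 1)) {b : Vec (d + 1)} (hb : inner ℝ v b = 0) :
    ∫ z, d * (c + inner ℝ a z) * inner ℝ b z ∂uniformPerp v = inner ℝ a b := by
  have hlin : Integrable (fun z => inner ℝ b z) (uniformPerp v) :=
    integrable_uniformPerp hd hv (by fun_prop)
  have hquad : Integrable (fun z => inner ℝ a z * inner ℝ b z) (uniformPerp v) :=
    integrable_uniformPerp hd hv (by fun_prop)
  simp only [mul_assoc, add_mul]
  rw [integral_const_mul, integral_add (hlin.const_mul c) hquad, integral_const_mul,
    integral_inner_uniformPerp, integral_inner_mul_inner_uniformPerp hd hv a hb]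
  field_simp
  ring

end Perp

/-! ### Conditional laws -/

section ConditionalLaw

variable {Ω β V : Type*} {m mΩ : MeasurableSpace Ω} {mβ : MeasurableSpace β} [MeasurableSpace V]
  {P : Measure Ω} {X : Ω → β} {Y : Ω → V} {κ : Ω → Measure V}

/-- `κ` is the conditional law of `Y` given the `σ`-algebra `m`, tested on each measurable set
separately: `κ` is not required to be a kernel. -/
def HasCondLaw (P : Measure Ω) (m : MeasurableSpace Ω) (Y : Ω → V) (κ : Ω → Measure V) : Prop :=
  ∀ B : Set V, MeasurableSet B →
    P[(Y ⁻¹' B).indicator (fun _ => (1 : ℝ)) | m] =ᵐ[P] fun ω => (κ ω).real B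

namespace HasCondLaw

variable [StandardBorelSpace V] [Nonempty V] [IsProbabilityMeasure P]
  [∀ ω, IsProbabilityMeasure (κ ω)]

lemma condDistrib_ae_eq (h : HasCondLaw P (mβ.comap X) Y κ) (hX : Measurable X)
    (hY : Measurable Y) : ∀ᵐ ω ∂P, condDistrib Y X P (X ω) = κ ω := by
  set 𝒜 := generateSetAlgebra (MeasurableSpace.countableGeneratingSet V) with h𝒜
  have hcount : 𝒜.Countable :=
    countable_generateSetAlgebra MeasurableSpace.countable_countableGeneratingSet
  have hgen : ‹MeasurableSpace V› = MeasurableSpace.generateFrom 𝒜 := by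
    rw [h𝒜, generateFrom_generateSetAlgebra_eq,
      MeasurableSpace.generateFrom_countableGeneratingSet]
  have hpi : IsPiSystem 𝒜 := fun s hs t ht _ => isSetAlgebra_generateSetAlgebra.inter_mem hs ht
  have hmeas : ∀ s ∈ 𝒜, MeasurableSet s := fun s hs => by
    rw [hgen]; exact MeasurableSpace.measurableSet_generateFrom hs
  have heq : ∀ᵐ ω ∂P, ∀ s ∈ 𝒜, (condDistrib Y X P (X ω)).real s = (κ ω).real s := by
    refine (ae_ball_iff hcount).2 fun s hs => ?_
    exact (condDistrib_ae_eq_condExp hX hY (hmeas s hs)).trans (h s (hmeas s hs))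
  filter_upwards [heq] with ω hω
  refine ext_of_generate_finite 𝒜 hgen hpi (fun s hs => ?_) (by simp)
  exact (ENNReal.toReal_eq_toReal_iff' (measure_ne_top _ _) (measure_ne_top _ _)).1 (hω s hs)

lemma integral_comp (h : HasCondLaw P m Y κ) (hm : m ≤ mΩ) (hX : Measurable[m] X)
    (hY : Measurable Y) {Φ : β × V → ℝ} (hΦ : Measurable Φ)
    (hint : Integrable (fun ω => Φ (X ω, Y ω)) P) :
    ∫ ω, Φ (X ω, Y ω) ∂P = ∫ ω, ∫ y, Φ (X ω, y) ∂κ ω ∂P := by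
  have hΦX : Measurable[m.prod _] fun z : Ω × V => Φ (X z.1, z.2) :=
    hΦ.comp ((hX.comp measurable_fst).prodMk measurable_snd)
  have hcond := condExp_prod_ae_eq_integral_condDistrib (mβ := m) (X := id) (measurable_id'' hm)
    hY.aemeasurable hΦX.stronglyMeasurable hint
  rw [← MeasurableSpace.comap_id (m := m)] at h
  have hlaw := h.condDistrib_ae_eq (measurable_id'' hm) hY
  rw [MeasurableSpace.comap_id] at hcond
  rw [← integral_condExp hm]
  refine integral_congr_ae ?_
  filter_upwards [hcond, hlaw] with ω hω hκ
  rw [← hκ]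
  exact hω

lemma ae_of_forall_ae (h : HasCondLaw P m Y κ) (hm : m ≤ mΩ) (hX : Measurable[m] X)
    (hY : Measurable Y) {p : β × V → Prop} (hp : MeasurableSet {z | p z})
    (hae : ∀ ω, ∀ᵐ y ∂κ ω, p (X ω, y)) : ∀ᵐ ω ∂P, p (X ω, Y ω) := by
  have hpXY : MeasurableSet {ω | ¬ p (X ω, Y ω)} := ((hX.mono hm le_rfl).prodMk hY) hp.compl
  have hint : Integrable ({ω | ¬ p (X ω, Y ω)}.indicator (1 : Ω → ℝ)) P :=
    (integrable_const 1).indicator hpXY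
  have hzero (ω : Ω) : ∫ y, {y | ¬ p (X ω, y)}.indicator (1 : V → ℝ) y ∂κ ω = 0 := by
    have hpX : MeasurableSet {y | ¬ p (X ω, y)} := measurable_prodMk_left hp.compl
    rw [integral_indicator_one hpX, measureReal_eq_zero_iff]
    exact hae ω
  rw [ae_iff, ← measureReal_eq_zero_iff]
  calc P.real {ω | ¬ p (X ω, Y ω)}
      = ∫ ω, {ω | ¬ p (X ω, Y ω)}.indicator (1 : Ω → ℝ) ω ∂P := (integral_indicator_one hpXY).symm
    _ = ∫ ω, ∫ y, {y | ¬ p (X ω, y)}.indicator (1 : V → ℝ) y ∂κ ω ∂P :=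
      h.integral_comp hm hX hY (Φ := {z | ¬ p z}.indicator 1)
        (measurable_one.indicator hp.compl) hint
    _ = 0 := by simp only [hzero, integral_zero]

end HasCondLaw

end ConditionalLaw

/-! ### The lifted decision set -/

section Coordinates

variable {d : ℕ}

@[simp] lemma firstCoords_apply (z : Vec (d + 1)) (i : Fin d) :
    firstCoords z i = z i.castSucc := rfl

@[simp] lemma pair_castSucc (x : Vec d) (b : ℝ) (i : Fin d) : pair x b i.castSucc = x i := by
  simp [pair]

@[simp] lemma pair_last (x : Vec d) (b : ℝ) : pair x b (Fin.last d) = b := by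
  simp [pair]

@[simp] lemma firstCoords_pair (x : Vec d) (b : ℝ) : firstCoords (pair x b) = x := by
  ext i; simp

lemma pair_firstCoords (z : Vec (d + 1)) : pair (firstCoords z) (z (Fin.last d)) = z := by
  ext i
  induction i using Fin.lastCases <;> simp

lemma firstCoords_add (z w : Vec (d + 1)) :
    firstCoords (z + w) = firstCoords z + firstCoords w := by
  ext i; simp

lemma firstCoords_sub (z w : Vec (d + 1)) :
    firstCoords (z - w) = firstCoords z - firstCoords w := by
  ext i; simp

lemma firstCoords_smul (c : ℝ) (z : Vec (d + 1)) : firstCoords (c • z) = c • firstCoords z := by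
  ext i; simp

lemma smul_pair_add_smul_pair (a b s t : ℝ) (x y : Vec d) :
    a • pair x s + b • pair y t = pair (a • x + b • y) (a * s + b * t) := by
  ext i
  induction i using Fin.lastCases <;> simp

lemma continuous_firstCoords : Continuous (firstCoords : Vec (d + 1) → Vec d) := by
  unfold firstCoords
  fun_prop

lemma continuous_pair (b : ℝ) : Continuous fun x : Vec d => pair x b := by
  unfold pair
  refine (PiLp.continuous_toLp 2 _).comp (continuous_pi fun i => ?_)
  induction i using Fin.lastCases
  · simpa only [Fin.snoc_last] using continuous_const
  · simp only [Fin.snoc_castSucc]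
    fun_prop

lemma inner_firstCoords (θ : Vec d) (z : Vec (d + 1)) :
    inner ℝ θ (firstCoords z) = inner ℝ (pair θ 0) z := by
  simp [PiLp.inner_apply, Fin.sum_univ_castSucc]

end Coordinates

section Con

variable {d : ℕ} {K : Set (Vec d)} {z : Vec (d + 1)}

lemma last_nonneg_of_mem_con (hz : z ∈ con K) : 0 ≤ z (Fin.last d) := by
  rcases hz with rfl | ⟨x, b, hb, -, rfl⟩
  · simp
  · simpa using hb.le

lemma firstCoords_mem_of_mem_con (hz : z ∈ con K) (hlast : z (Fin.last d) = 1) :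
    firstCoords z ∈ K := by
  rcases hz with rfl | ⟨x, b, -, hx, rfl⟩
  · simp at hlast
  · rw [pair_last] at hlast
    subst hlast
    simpa using hx

lemma pair_one_mem_con_iff {x : Vec d} : pair x 1 ∈ con K ↔ x ∈ K := by
  refine ⟨fun h => ?_, fun h => Or.inr ⟨x, 1, one_pos, by simpa using h, rfl⟩⟩
  simpa using firstCoords_mem_of_mem_con h (by simp)

lemma mem_con_of_gauge_lt (hK : Convex ℝ K) (h0 : K ∈ 𝓝 0)
    (hz : gauge K (firstCoords z) < z (Fin.last d)) : z ∈ con K := by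
  have hlast : 0 < z (Fin.last d) := (gauge_nonneg _).trans_lt hz
  refine Or.inr ⟨firstCoords z, z (Fin.last d), hlast, ?_, (pair_firstCoords z).symm⟩
  refine setOfPred_gauge_lt_one_subset_self hK (mem_of_mem_nhds h0) (absorbent_nhds_zero h0) ?_
  change gauge K ((1 / z (Fin.last d)) • firstCoords z) < 1
  rwa [gauge_smul_of_nonneg (by positivity), smul_eq_mul, one_div, inv_mul_lt_iff₀ hlast, mul_one]

lemma mem_interior_con (hK : Convex ℝ K) (h0 : K ∈ 𝓝 0)
    (hz : gauge K (firstCoords z) < z (Fin.last d)) : z ∈ interior (con K) :=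
  mem_interior.2 ⟨{w | gauge K (firstCoords w) < w (Fin.last d)},
    fun _ hw => mem_con_of_gauge_lt hK h0 hw,
    isOpen_lt ((continuous_gauge hK h0).comp continuous_firstCoords) (by fun_prop), hz⟩

lemma last_pos_of_mem_interior_con (hz : z ∈ interior (con K)) : 0 < z (Fin.last d) := by
  have hcont : Tendsto (fun s : ℝ => z - s • EuclideanSpace.single (Fin.last d) (1 : ℝ))
      (𝓝[>] 0) (𝓝 z) :=
    (Continuous.tendsto' (by fun_prop) _ _ (by simp)).mono_left nhdsWithin_le_nhds
  obtain ⟨s, hmem, hs⟩ :=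
    ((hcont.eventually_mem (isOpen_interior.mem_nhds hz)).and self_mem_nhdsWithin).exists
  have hlast := last_nonneg_of_mem_con (interior_subset hmem)
  simp only [PiLp.sub_apply, PiLp.smul_apply, EuclideanSpace.single, PiLp.single_apply, if_true,
    smul_eq_mul, mul_one] at hlast
  exact lt_of_lt_of_le hs (sub_nonneg.1 hlast)

namespace IsClosedProperCone

lemma isClosed_base (h : IsClosedProperCone (con K)) : IsClosed K := by
  simpa only [Set.preimage, pair_one_mem_con_iff, Set.ofPred_mem_eq] using
    h.isClosed.preimage (continuous_pair 1)

lemma convex_base (h : IsClosedProperCone (con K)) : Convex ℝ K := by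
  intro x hx y hy a b ha hb hab
  rw [← pair_one_mem_con_iff] at hx hy ⊢
  simpa only [smul_pair_add_smul_pair, mul_one, hab] using h.convex hx hy ha hb hab

lemma nonempty_interior_base (h : IsClosedProperCone (con K)) : (interior K).Nonempty := by
  obtain ⟨z, hz⟩ := h.nonempty_interior
  have hlast := last_pos_of_mem_interior_con hz
  set w := (z (Fin.last d))⁻¹ • z with hw
  have hwi : w ∈ interior (con K) := h.smul_mem_interior hz (inv_pos.2 hlast)
  have hw1 : w (Fin.last d) = 1 := by simp [hw, hlast.ne']
  refine ⟨firstCoords w, mem_interior.2 ⟨(fun y => pair y 1) ⁻¹' interior (con K),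
    fun y hy => pair_one_mem_con_iff.1 (interior_subset hy),
    isOpen_interior.preimage (continuous_pair 1), ?_⟩⟩
  rwa [Set.mem_preimage, ← hw1, pair_firstCoords]

lemma base_mem_nhds_zero (h : IsClosedProperCone (con K)) (hsymm : ∀ x ∈ K, -x ∈ K) :
    K ∈ 𝓝 0 := by
  obtain ⟨x, hx⟩ := h.nonempty_interior_base
  have hneg : -x ∈ interior K := by
    refine interior_maximal (fun y hy => ?_) isOpen_interior.neg (by simpa using hx)
    simpa using hsymm _ (interior_subset hy)
  have hmid := h.convex_base.interior hx hneg (a := 1 / 2) (b := 1 / 2)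
    (by norm_num) (by norm_num) (by norm_num)
  rw [smul_neg, add_neg_cancel] at hmid
  exact mem_interior_iff_mem_nhds.1 hmid

end IsClosedProperCone

end Con

section LiftShrink

variable {d : ℕ} {K : Set (Vec d)} {δ : ℝ} {x z : Vec (d + 1)}

lemma lift_shrink_eq_image (hδ : δ < 1) :
    lift (shrink δ K) = (fun x => pair ((1 - δ) • x) 1) '' K := by
  have h1δ : 1 - δ ≠ 0 := by linarith
  ext z
  constructor
  · rintro ⟨x, hx, rfl⟩
    exact ⟨_, hx, by simp [smul_smul, h1δ]⟩
  · rintro ⟨x, hx, rfl⟩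
    exact ⟨_, by simpa [shrink, smul_smul, h1δ] using hx, rfl⟩

lemma pair_smul_mem_lift_shrink (hδ : δ < 1) {x : Vec d} (hx : x ∈ K) :
    pair ((1 - δ) • x) 1 ∈ lift (shrink δ K) := by
  rw [lift_shrink_eq_image hδ]
  exact Set.mem_image_of_mem _ hx

lemma isCompact_lift_shrink (hK : IsCompact K) (hδ : δ < 1) :
    IsCompact (lift (shrink δ K)) := by
  rw [lift_shrink_eq_image hδ]
  exact hK.image ((continuous_pair 1).comp (continuous_const_smul _))

lemma convex_lift_shrink (hK : Convex ℝ K) : Convex ℝ (lift (shrink δ K)) := by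
  rintro _ ⟨x, hx, rfl⟩ _ ⟨y, hy, rfl⟩ a b ha hb hab
  refine ⟨a • x + b • y, ?_, by simp [smul_pair_add_smul_pair, hab]⟩
  change (1 / (1 - δ)) • (a • x + b • y) ∈ K
  rw [smul_add, smul_comm _ a, smul_comm _ b]
  exact hK hx hy ha hb hab

lemma last_of_mem_lift {S : Set (Vec d)} (hz : z ∈ lift S) : z (Fin.last d) = 1 := by
  obtain ⟨x, -, rfl⟩ := hz
  simp

lemma gauge_firstCoords_le (hδ : δ < 1) (hz : z ∈ lift (shrink δ K)) :
    gauge K (firstCoords z) ≤ 1 - δ := by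
  rw [lift_shrink_eq_image hδ] at hz
  obtain ⟨x, hx, rfl⟩ := hz
  rw [firstCoords_pair]
  exact gauge_le_of_mem (by linarith) (Set.smul_mem_smul_set hx)

namespace IsClosedProperCone

lemma lift_shrink_subset_interior (h : IsClosedProperCone (con K)) (hsymm : ∀ x ∈ K, -x ∈ K)
    (hδ0 : 0 < δ) (hδ : δ < 1) : lift (shrink δ K) ⊆ interior (con K) := fun z hz =>
  mem_interior_con h.convex_base (h.base_mem_nhds_zero hsymm) <| by
    rw [last_of_mem_lift hz]
    linarith [gauge_firstCoords_le hδ hz]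

lemma add_smul_sub_mem_interior (h : IsClosedProperCone (con K)) (hsymm : ∀ x ∈ K, -x ∈ K)
    (hδ : δ < 1) (hx : x ∈ lift (shrink δ K)) (hz : z ∈ lift (shrink δ K)) {s : ℝ} (hs : 0 ≤ s)
    (hsδ : s * (2 * (1 - δ)) < δ) : x + s • (x - z) ∈ interior (con K) := by
  have h0 := h.base_mem_nhds_zero hsymm
  have hadd := gauge_add_le h.convex_base (absorbent_nhds_zero h0)
  refine mem_interior_con h.convex_base h0 ?_
  have hlast : (x + s • (x - z)) (Fin.last d) = 1 := by
    simp [last_of_mem_lift hx, last_of_mem_lift hz]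
  rw [hlast, firstCoords_add, firstCoords_smul, firstCoords_sub, sub_eq_add_neg]
  calc gauge K (firstCoords x + s • (firstCoords x + -firstCoords z))
      ≤ gauge K (firstCoords x) + s * (gauge K (firstCoords x) + gauge K (firstCoords z)) := by
        refine (hadd _ _).trans ?_
        rw [gauge_smul_of_nonneg hs, smul_eq_mul]
        gcongr
        exact (hadd _ _).trans_eq (by rw [gauge_neg hsymm])
    _ ≤ (1 - δ) + s * ((1 - δ) + (1 - δ)) := by
        gcongr <;> exact gauge_firstCoords_le hδ ‹_›
    _ < 1 := by linarith

lemma sub_smul_mem_interior (h : IsClosedProperCone (con K)) (hsymm : ∀ x ∈ K, -x ∈ K)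
    (hδ : δ < 1) (hx : x ∈ lift (shrink δ K)) (hz : z ∈ lift (shrink δ K)) {κ : ℝ} (hκ : 0 ≤ κ)
    (hκδ : κ * (2 - δ) < δ) : z - κ • x ∈ interior (con K) := by
  have h0 := h.base_mem_nhds_zero hsymm
  refine mem_interior_con h.convex_base h0 ?_
  have hlast : (z - κ • x) (Fin.last d) = 1 - κ := by
    simp [last_of_mem_lift hx, last_of_mem_lift hz]
  rw [hlast, firstCoords_sub, firstCoords_smul, sub_eq_add_neg]
  calc gauge K (firstCoords z + -(κ • firstCoords x))
      ≤ gauge K (firstCoords z) + κ * gauge K (firstCoords x) := by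
        refine (gauge_add_le h.convex_base (absorbent_nhds_zero h0) _ _).trans_eq ?_
        rw [gauge_neg hsymm, gauge_smul_of_nonneg hκ, smul_eq_mul]
    _ ≤ (1 - δ) + κ * (1 - δ) := by
        gcongr <;> exact gauge_firstCoords_le hδ ‹_›
    _ < 1 - κ := by linarith

end IsClosedProperCone

lemma rpow_five_thirds_mul_lt (hδ0 : 0 < δ) (hδ : δ ≤ 1 / 2) :
    δ ^ (5 / 3 : ℝ) * (2 - δ) < δ := by
  have hcube : (δ ^ (5 / 3 : ℝ)) ^ 3 = δ ^ 5 := by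
    rw [← Real.rpow_natCast, ← Real.rpow_mul hδ0.le, ← Real.rpow_natCast]
    norm_num
  have hlt : δ ^ 2 * (2 - δ) ^ 3 < 1 := by
    have : 0 ≤ δ ^ 3 * (1 / 2 - δ) := mul_nonneg (by positivity) (by linarith)
    have : 0 < δ ^ 5 := by positivity
    nlinarith [sq_nonneg (δ - 1 / 2), mul_nonneg hδ0.le (sq_nonneg (δ - 1 / 2))]
  refine lt_of_pow_lt_pow_left₀ 3 hδ0.le ?_
  calc (δ ^ (5 / 3 : ℝ) * (2 - δ)) ^ 3 = δ ^ 3 * (δ ^ 2 * (2 - δ) ^ 3) := by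
        rw [mul_pow, hcube]; ring
    _ < δ ^ 3 * 1 := by gcongr
    _ = δ ^ 3 := mul_one _

namespace IsNormalBarrier

variable {ν : ℝ} {R : Vec (d + 1) → ℝ}

lemma localNorm_sub_le_of_mem_lift (hR : IsNormalBarrier (con K) ν R)
    (hsymm : ∀ x ∈ K, -x ∈ K) (hδ0 : 0 < δ) (hδ : δ ≤ 1 / 2) (hx : x ∈ lift (shrink δ K))
    (hz : z ∈ lift (shrink δ K)) :
    localNorm R x (z - x) ≤ 2 * (ν + 2 * √ν) * ((1 - δ) / δ) := by
  have hν := hR.one_le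
  have hsν : 0 < √ν := Real.sqrt_pos.2 (by linarith)
  have hδ1 : δ < 1 := by linarith
  have h1δ : 0 < 1 - δ := by linarith
  have hsub := hR.cone.lift_shrink_subset_interior hsymm hδ0 hδ1
  set s := δ / (2 * (1 - δ)) * (ν / (ν + 2 * √ν)) with hs
  have hs0 : 0 < s := by positivity
  have hratio : ν / (ν + 2 * √ν) < 1 := by rw [div_lt_one (by positivity)]; linarith
  have hsδ : s * (2 * (1 - δ)) < δ :=
    calc s * (2 * (1 - δ)) = δ * (ν / (ν + 2 * √ν)) := by rw [hs]; field_simp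
      _ < δ := mul_lt_of_lt_one_right hδ0 hratio
  calc localNorm R x (z - x) ≤ ν / s :=
        hR.localNorm_sub_le_div (hsub hx) (hsub hz) hs0 (by nlinarith)
          (hR.cone.add_smul_sub_mem_interior hsymm hδ1 hx hz hs0.le hsδ)
    _ = 2 * (ν + 2 * √ν) * ((1 - δ) / δ) := by rw [hs]; field_simp

lemma sub_le_of_mem_lift (hR : IsNormalBarrier (con K) ν R) (hsymm : ∀ x ∈ K, -x ∈ K)
    (hδ0 : 0 < δ) (hδ : δ ≤ 1 / 2) (hx : x ∈ lift (shrink δ K)) (hz : z ∈ lift (shrink δ K)) :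
    R z - R x ≤ 5 / 3 * (ν * Real.log (1 / δ)) := by
  have hδ1 : δ < 1 := by linarith
  have hκ : 0 < δ ^ (5 / 3 : ℝ) := by positivity
  calc R z - R x ≤ ν * Real.log (1 / δ ^ (5 / 3 : ℝ)) :=
        hR.sub_le_mul_log (hR.cone.lift_shrink_subset_interior hsymm hδ0 hδ1 hx) hκ <|
          hR.cone.sub_smul_mem_interior hsymm hδ1 hx hz hκ.le (rpow_five_thirds_mul_lt hδ0 hδ)
    _ = 5 / 3 * (ν * Real.log (1 / δ)) := by
        rw [one_div, one_div, Real.log_inv, Real.log_inv, Real.log_rpow hδ0]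
        ring

end IsNormalBarrier

end LiftShrink

/-! ### One round -/

lemma continuousOn_mulVecE {n : ℕ} {X : Type*} [TopologicalSpace X] {S : Set X}
    {A : X → Matrix (Fin n) (Fin n) ℝ} {w : X → Vec n} (hA : ContinuousOn A S)
    (hw : ContinuousOn w S) : ContinuousOn (fun x => mulVecE (A x) (w x)) S := by
  rw [continuousOn_iff_continuous_domRestrict] at hA hw ⊢
  exact (PiLp.continuous_toLp 2 _).comp
    (hA.matrix_mulVec ((PiLp.continuous_ofLp 2 _).comp hw))

section Round

variable {d : ℕ} {R : Vec (d + 1) → ℝ} {x u : Vec (d + 1)}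

lemma inner_estimator (f : Vec d → ℝ) (h : Vec (d + 1)) :
    inner ℝ (estimator R f x u) h =
      d * f (play R x u) * inner ℝ (mulVecE (scaling R x)⁻¹ h) u := by
  rw [estimator, real_inner_smul_left, inner_mulVecE_comm (scaling_inv_transpose R x),
    real_inner_comm]

lemma inner_play (θ : Vec d) :
    inner ℝ θ (play R x u) =
      inner ℝ (pair θ 0) x + inner ℝ (mulVecE (scaling R x) (pair θ 0)) u := by
  rw [play, inner_firstCoords, inner_add_right, inner_mulVecE_comm (scaling_transpose R x)]

/-- The error, for a loss with linear part `θ` and against the comparator `w`, made in a round when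
the regret is read off the estimator of the linear part of the loss. -/
def roundError (R : Vec (d + 1) → ℝ) (θ w : Vec d) (x u : Vec (d + 1)) : ℝ :=
  inner ℝ (estimator R (fun y => inner ℝ θ y) x u) (x - pair w 1) - inner ℝ θ (play R x u - w)

lemma roundError_eq (θ w : Vec d) :
    roundError R θ w x u =
      d * (inner ℝ (pair θ 0) x + inner ℝ (mulVecE (scaling R x) (pair θ 0)) u) *
          inner ℝ (mulVecE (scaling R x)⁻¹ (x - pair w 1)) u -
        (inner ℝ (pair θ 0) x - inner ℝ θ w + inner ℝ (mulVecE (scaling R x) (pair θ 0)) u) := by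
  rw [roundError, inner_estimator, inner_sub_right, inner_play]
  ring

namespace IsNormalBarrier

variable {n : ℕ} {Ψ : Set (Vec n)} {ν : ℝ} {S : Vec n → ℝ} {y v : Vec n}

lemma scaling_mulVecE_ne_zero (hS : IsNormalBarrier Ψ ν S) (hy : y ∈ interior Ψ) (hv : v ≠ 0) :
    mulVecE (scaling S y) v ≠ 0 := by
  intro hzero
  refine hv (norm_eq_zero.1 ?_)
  rw [← hS.localNorm_scaling hy, hzero, ← zero_smul ℝ v, localNorm_smul, abs_zero, zero_mul]

lemma inner_scaling_scaling_inv (hS : IsNormalBarrier Ψ ν S) (hy : y ∈ interior Ψ)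
    (g h : Vec n) :
    inner ℝ (mulVecE (scaling S y) g) (mulVecE (scaling S y)⁻¹ h) = inner ℝ g h := by
  rw [inner_mulVecE_comm (scaling_transpose S y), mulVecE_mulVecE, hS.scaling_mul_inv hy,
    mulVecE_one]

lemma add_scaling_mem (hS : IsNormalBarrier Ψ ν S) (hy : y ∈ interior Ψ) (hv : ‖v‖ ≤ 1) :
    y + mulVecE (scaling S y) v ∈ Ψ := by
  have hcont : Tendsto (fun s : ℝ => y + s • mulVecE (scaling S y) v) (𝓝[<] 1)
      (𝓝 (y + mulVecE (scaling S y) v)) :=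
    (Continuous.tendsto' (by fun_prop) _ _ (by rw [one_smul])).mono_left nhdsWithin_le_nhds
  refine hS.cone.isClosed.mem_of_tendsto hcont ?_
  filter_upwards [Ioo_mem_nhdsLT (zero_lt_one' ℝ)] with s hs
  refine interior_subset (hS.add_mem_interior hy ?_)
  rw [localNorm_smul, hS.localNorm_scaling hy, abs_of_pos hs.1]
  exact (mul_le_of_le_one_right hs.1.le hv).trans_lt hs.2

lemma abs_inner_scaling_inv_le (hS : IsNormalBarrier Ψ ν S) (hy : y ∈ interior Ψ)
    (hv : ‖v‖ ≤ 1) (h : Vec n) :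
    |inner ℝ (mulVecE (scaling S y)⁻¹ h) v| ≤ localNorm S y h := by
  rw [← hS.norm_scaling_inv hy]
  exact (abs_real_inner_le_norm _ _).trans (mul_le_of_le_one_right (norm_nonneg _) hv)

lemma play_mem {K : Set (Vec d)} (hR : IsNormalBarrier (con K) ν R)
    (hx : x ∈ interior (con K)) (hlast : x (Fin.last d) = 1) (hu : ‖u‖ ≤ 1)
    (hperp : inner ℝ (mulVecE (scaling R x) (EuclideanSpace.single (Fin.last d) 1)) u = 0) :
    play R x u ∈ K := by
  refine firstCoords_mem_of_mem_con (hR.add_scaling_mem hx hu) ?_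
  rw [inner_mulVecE_comm (scaling_transpose R x), EuclideanSpace.inner_single_left, map_one,
    one_mul] at hperp
  rw [PiLp.add_apply, hlast, hperp, add_zero]

variable {Ψ : Set (Vec (d + 1))}

lemma abs_inner_estimator_le (hR : IsNormalBarrier Ψ ν R) (hx : x ∈ interior Ψ)
    (hu : ‖u‖ ≤ 1) {f : Vec d → ℝ} {c : ℝ} (hf : |f (play R x u)| ≤ c) (h : Vec (d + 1)) :
    |inner ℝ (estimator R f x u) h| ≤ d * c * localNorm R x h := by
  rw [inner_estimator, abs_mul, abs_mul, Nat.abs_cast]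
  have hc := (abs_nonneg _).trans hf
  gcongr
  exact hR.abs_inner_scaling_inv_le hx hu h

lemma inner_play_sub_le (hR : IsNormalBarrier Ψ ν R) (hx : x ∈ interior Ψ) (hu : ‖u‖ ≤ 1)
    {f : Vec d → ℝ} {θ : Vec d} {ε : ℝ} (hf : |f (play R x u) - inner ℝ θ (play R x u)| ≤ ε)
    (w : Vec d) :
    inner ℝ θ (play R x u - w) ≤ inner ℝ (estimator R f x u) (x - pair w 1) +
      d * ε * localNorm R x (x - pair w 1) - roundError R θ w x u := by
  have hdiff := (abs_le.1 (hR.abs_inner_estimator_le (f := fun y => f y - inner ℝ θ y) hx hu hf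
    (x - pair w 1))).1
  rw [roundError]
  rw [inner_estimator] at hdiff ⊢
  rw [inner_estimator]
  linarith

lemma integral_roundError_uniformPerp (hR : IsNormalBarrier Ψ ν R) (hd : 1 ≤ d)
    (hx : x ∈ interior Ψ) (hlast : x (Fin.last d) = 1) (θ w : Vec d) :
    ∫ u, roundError R θ w x u
      ∂uniformPerp (mulVecE (scaling R x) (EuclideanSpace.single (Fin.last d) 1)) = 0 := by
  set v := mulVecE (scaling R x) (EuclideanSpace.single (Fin.last d) 1) with hv
  have hv0 : v ≠ 0 := hR.scaling_mulVecE_ne_zero hx (by simp)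
  set a := mulVecE (scaling R x) (pair θ 0) with ha
  set b := mulVecE (scaling R x)⁻¹ (x - pair w 1) with hb
  have hperp : inner ℝ v b = 0 := by
    rw [hv, hb, hR.inner_scaling_scaling_inv hx]
    simp [EuclideanSpace.inner_single_left, hlast]
  have hab : inner ℝ a b = inner ℝ (pair θ 0) x - inner ℝ θ w := by
    rw [ha, hb, hR.inner_scaling_scaling_inv hx, inner_sub_right, ← inner_firstCoords _ (pair w 1),
      firstCoords_pair]
  have := isProbabilityMeasure_uniformPerp hd hv0
  have hest : Integrable (fun u => d * (inner ℝ (pair θ 0) x + inner ℝ a u) * inner ℝ b u)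
      (uniformPerp v) := integrable_uniformPerp hd hv0 (by fun_prop)
  have hlin : Integrable (fun u => inner ℝ a u) (uniformPerp v) :=
    integrable_uniformPerp hd hv0 (by fun_prop)
  have hplay : Integrable (fun u => inner ℝ (pair θ 0) x - inner ℝ θ w + inner ℝ a u)
      (uniformPerp v) := integrable_uniformPerp hd hv0 (by fun_prop)
  simp only [roundError_eq, ← ha, ← hb]
  rw [integral_sub hest hplay, integral_affine_mul_inner_uniformPerp hd hv0 _ _ hperp,
    integral_add (integrable_const _) hlin, integral_inner_uniformPerp, hab]
  simp

lemma continuousOn_roundError (hR : IsNormalBarrier Ψ ν R) (θ w : Vec d) :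
    ContinuousOn (fun z : Vec (d + 1) × Vec (d + 1) => roundError R θ w z.1 z.2)
      (interior Ψ ×ˢ Set.univ) := by
  have hfst : Set.MapsTo Prod.fst (interior Ψ ×ˢ (Set.univ : Set (Vec (d + 1)))) (interior Ψ) :=
    fun _ hz => hz.1
  have hA := hR.continuousOn_scaling.comp continuousOn_fst hfst
  have hA' := hR.continuousOn_scaling_inv.comp continuousOn_fst hfst
  have ha : ContinuousOn (fun z : Vec (d + 1) × Vec (d + 1) =>
      mulVecE (scaling R z.1) (pair θ 0)) (interior Ψ ×ˢ Set.univ) :=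
    continuousOn_mulVecE hA continuousOn_const
  have hb : ContinuousOn (fun z : Vec (d + 1) × Vec (d + 1) =>
      mulVecE (scaling R z.1)⁻¹ (z.1 - pair w 1)) (interior Ψ ×ˢ Set.univ) :=
    continuousOn_mulVecE hA' (by fun_prop)
  simp only [roundError_eq]
  fun_prop

lemma continuous_roundError_interior (hR : IsNormalBarrier Ψ ν R) (θ w : Vec d) :
    Continuous fun z : interior Ψ × Vec (d + 1) => roundError R θ w z.1 z.2 := by
  have hval : Continuous fun z : interior Ψ × Vec (d + 1) => ((z.1 : Vec (d + 1)), z.2) := by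
    fun_prop
  simpa only [Function.comp_def] using (hR.continuousOn_roundError θ w).comp_continuous hval
    fun z => Set.mk_mem_prod z.1.2 (Set.mem_univ z.2)

end IsNormalBarrier

end Round

/-! ### The parameters and the bound -/

section Parameters

variable {d T : ℕ} {ε : ℝ}

lemma deltaParam_zero (T : ℕ) : deltaParam T 0 = 1 / (T : ℝ) ^ 2 := if_pos rfl

lemma deltaParam_of_pos (hε : 0 < ε) : deltaParam T ε = √ε := if_neg hε.ne'

lemma deltaParam_pos (hT : 1 ≤ T) (hε : 0 ≤ ε) : 0 < deltaParam T ε := by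
  rcases hε.eq_or_lt with rfl | hε
  · rw [deltaParam_zero]
    positivity
  · rw [deltaParam_of_pos hε]
    exact Real.sqrt_pos.2 hε

lemma log_one_div_deltaParam_pos (hT : 1 ≤ T) (hε : 0 ≤ ε) (hδ : deltaParam T ε < 1) :
    0 < Real.log (1 / deltaParam T ε) :=
  Real.log_pos (one_lt_one_div (deltaParam_pos hT hε) hδ)

lemma two_le_of_deltaParam_zero_lt_one (hT : 1 ≤ T) (hδ : deltaParam T 0 < 1) : 2 ≤ T := by
  refine Nat.lt_of_le_of_ne hT ?_
  rintro rfl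
  norm_num [deltaParam_zero] at hδ

lemma sq_deltaParam_eq (hT : 1 ≤ T) (hε : 0 ≤ ε) (hδ : deltaParam T ε < 1)
    (hhalf : 1 / 2 < deltaParam T ε) : deltaParam T ε ^ 2 = ε := by
  rcases hε.eq_or_lt with rfl | hε
  · have hT2 : (2 : ℝ) ≤ T := by exact_mod_cast two_le_of_deltaParam_zero_lt_one hT hδ
    rw [deltaParam_zero, div_lt_div_iff₀ two_pos (by positivity)] at hhalf
    nlinarith
  · rw [deltaParam_of_pos hε, Real.sq_sqrt hε.le]

lemma one_sub_deltaParam_div_mul_le (hT : 1 ≤ T) (hε : 0 ≤ ε) :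
    (1 - deltaParam T ε) / deltaParam T ε * ε ≤ √ε := by
  have hpos := deltaParam_pos hT hε
  rcases hε.eq_or_lt with rfl | hε
  · simp
  · rw [deltaParam_of_pos hε] at hpos ⊢
    rw [div_mul_eq_mul_div, div_le_iff₀ hpos, Real.mul_self_sqrt hε.le]
    nlinarith

lemma deltaParam_mul_le (hd : 1 ≤ d) (hT : 1 ≤ T) (hε : 0 ≤ ε) (hδ : deltaParam T ε < 1) :
    deltaParam T ε * T ≤ √(Real.log (1 / deltaParam T ε)) * (d * √T) + √ε * d * T := by
  have hd' : (1 : ℝ) ≤ d := by exact_mod_cast hd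
  rcases hε.eq_or_lt with rfl | hε
  · have hT2 : (2 : ℝ) ≤ T := by exact_mod_cast two_le_of_deltaParam_zero_lt_one hT hδ
    have hlog : 1 ≤ Real.log ((T : ℝ) ^ 2) := by
      rw [Real.log_pow]
      push_cast
      linarith [Real.log_le_log two_pos hT2, Real.log_two_gt_d9]
    rw [deltaParam_zero, one_div_one_div, Real.sqrt_zero, zero_mul, zero_mul, add_zero]
    calc 1 / (T : ℝ) ^ 2 * T = 1 / T := by field_simp
      _ ≤ 1 := by rw [div_le_one (by positivity)]; linarith
      _ ≤ √(Real.log ((T : ℝ) ^ 2)) * (d * √T) :=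
        one_le_mul_of_one_le_of_one_le (Real.one_le_sqrt.2 hlog)
          (one_le_mul_of_one_le_of_one_le hd' (Real.one_le_sqrt.2 (by linarith)))
  · rw [deltaParam_of_pos hε]
    calc √ε * T ≤ √ε * d * T := by
          gcongr
          exact le_mul_of_one_le_right (Real.sqrt_nonneg ε) hd'
      _ ≤ √(Real.log (1 / √ε)) * (d * √T) + √ε * d * T := le_add_of_nonneg_left (by positivity)

end Parameters

section Bound

variable {d T : ℕ} {ν G D ε δ : ℝ}

lemma regretBound_deltaParam_le (hd : 1 ≤ d) (hT : 1 ≤ T) (hε : 0 ≤ ε)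
    (hδ : deltaParam T ε < 1) :
    regretBound d T ν G D ε (deltaParam T ε) ≤
      (4 * √ν + 2 * (|ν| + 2 * √ν) + |G * D| + 2) *
        (√(Real.log (1 / deltaParam T ε)) * (d * √T) + √ε * d * T + ε * d * T) := by
  have hd' : (1 : ℝ) ≤ d := by exact_mod_cast hd
  have hL := (log_one_div_deltaParam_pos hT hε hδ).le
  have hδT := deltaParam_mul_le hd hT hε hδ
  have hδ0 := deltaParam_pos hT hε
  have hratio := one_sub_deltaParam_div_mul_le hT hε
  have hratio0 : 0 ≤ (1 - deltaParam T ε) / deltaParam T ε * ε :=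
    mul_nonneg (div_nonneg (by linarith) hδ0.le) hε
  set δ := deltaParam T ε
  set A := √(Real.log (1 / δ)) * (d * √T) with hA
  have hdeviation : 4 * d * √(ν * T * Real.log (1 / δ)) = 4 * √ν * A := by
    rw [Real.sqrt_mul' _ hL, Real.sqrt_mul' _ (by positivity : (0 : ℝ) ≤ T), hA]
    ring
  have hbias : 2 * d * T * (ν + 2 * √ν) * ((1 - δ) / δ) * ε ≤
      2 * (|ν| + 2 * √ν) * (√ε * d * T) :=
    calc _ = 2 * (ν + 2 * √ν) * (d * T * ((1 - δ) / δ * ε)) := by ring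
      _ ≤ 2 * (|ν| + 2 * √ν) * (d * T * √ε) := by gcongr; exact le_abs_self ν
      _ = _ := by ring
  have hshrink : δ * G * D * T ≤ |G * D| * (A + √ε * d * T) :=
    calc _ = G * D * (δ * T) := by ring
      _ ≤ |G * D| * (A + √ε * d * T) := by gcongr; exact le_abs_self _
  have hcomparator : 2 * T * ε ≤ 2 * (ε * d * T) := by
    nlinarith [mul_nonneg hε (Nat.cast_nonneg T : (0 : ℝ) ≤ T)]
  have hslack : 0 ≤ 4 * √ν * (√ε * d * T + ε * d * T) + 2 * (|ν| + 2 * √ν) * (A + ε * d * T) +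
      |G * D| * (ε * d * T) + 2 * (A + √ε * d * T) := by positivity
  rw [regretBound, hdeviation]
  linarith

lemma two_mul_le_regretBound_of_half_le (hd : 1 ≤ d) (hν : 1 ≤ ν) (hGD : 0 ≤ G * D)
    (hδ : 1 / 2 ≤ δ) (hδ1 : δ < 1) : 2 * T ≤ regretBound d T ν G D (δ ^ 2) δ := by
  have h1δ : 0 < 1 - δ := by linarith
  have : 0 < δ := by linarith
  have hd' : (1 : ℝ) ≤ d := by exact_mod_cast hd
  have hsν : 1 ≤ √ν := Real.one_le_sqrt.2 hν
  have hdeviation : 0 ≤ 4 * d * √(ν * T * Real.log (1 / δ)) := by positivity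
  have hbias : 6 * ((1 - δ) * δ) * T ≤
      2 * d * T * (ν + 2 * √ν) * ((1 - δ) / δ) * δ ^ 2 :=
    calc 6 * ((1 - δ) * δ) * T = 2 * (1 * (1 + 2 * 1)) * ((1 - δ) * δ) * T := by ring
      _ ≤ 2 * (d * (ν + 2 * √ν)) * ((1 - δ) * δ) * T := by gcongr
      _ = _ := by field_simp
  have hshrink : 0 ≤ G * D * (δ * T) := by positivity
  have hquad : 2 * T ≤ 6 * ((1 - δ) * δ) * T + 2 * T * δ ^ 2 := by
    have : 0 ≤ (2 * δ - 1) * (1 - δ) * T :=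
      mul_nonneg (mul_nonneg (by linarith) h1δ.le) (Nat.cast_nonneg T)
    linarith
  rw [regretBound]
  linarith

lemma two_mul_le_regretBound_of_le (hd : 1 ≤ d) (hν : 0 ≤ ν) (hGD : 0 ≤ G * D) (hε : 0 ≤ ε)
    (hδ0 : 0 < δ) (hδ1 : δ < 1) (hT : (T : ℝ) ≤ 4 * d ^ 2 * (ν * Real.log (1 / δ))) :
    2 * T ≤ regretBound d T ν G D ε δ := by
  have : 0 < 1 - δ := by linarith
  have : (0 : ℝ) < d := by exact_mod_cast hd
  have hsqrt : (T : ℝ) / (2 * d) ≤ √(ν * T * Real.log (1 / δ)) := by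
    refine Real.le_sqrt_of_sq_le ?_
    rw [div_pow, div_le_iff₀ (by positivity)]
    linarith [mul_le_mul_of_nonneg_left hT (Nat.cast_nonneg T)]
  rw [div_le_iff₀ (by positivity)] at hsqrt
  have hbias : 0 ≤ 2 * d * T * (ν + 2 * √ν) * ((1 - δ) / δ) * ε := by positivity
  have hshrink : 0 ≤ G * D * (δ * T) := by positivity
  have hcomparator : 0 ≤ 2 * T * ε := by positivity
  rw [regretBound]
  linarith

lemma etaParam_pos (hd : 1 ≤ d) (hT : 1 ≤ T) (hL : 0 < ν * Real.log (1 / δ)) :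
    0 < etaParam d T ν δ := by
  rw [etaParam]
  positivity

lemma etaParam_mul_le (hd : 1 ≤ d) (hT : 1 ≤ T) (hL : 0 ≤ ν * Real.log (1 / δ))
    (hLT : 4 * d ^ 2 * (ν * Real.log (1 / δ)) ≤ T) : etaParam d T ν δ * d ≤ 1 / 4 := by
  have hd' : (1 : ℝ) ≤ d := by exact_mod_cast hd
  have hT' : (0 : ℝ) < √T := by positivity
  have hsqrt : 2 * d * √(ν * Real.log (1 / δ)) ≤ √T := by
    refine Real.le_sqrt_of_sq_le ?_
    rw [mul_pow, Real.sq_sqrt hL]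
    linarith
  rw [etaParam, div_mul_eq_mul_div, div_le_div_iff₀ (by positivity) (by norm_num)]
  nlinarith

lemma etaParam_balance (hd : 1 ≤ d) (hT : 1 ≤ T) (hL : 0 ≤ ν * Real.log (1 / δ)) :
    5 / 3 * (ν * Real.log (1 / δ)) + T * (4 / 3 * (etaParam d T ν δ * d) ^ 2) =
      etaParam d T ν δ * (4 * d * √(ν * T * Real.log (1 / δ))) := by
  have hsqrt : √(ν * T * Real.log (1 / δ)) = √(ν * Real.log (1 / δ)) * √T := by
    rw [← Real.sqrt_mul hL]
    congr 1
    ring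
  have : (0 : ℝ) < √T := by positivity
  rw [hsqrt, etaParam]
  nth_rewrite 1 [← Real.sq_sqrt hL]
  nth_rewrite 1 [← Real.sq_sqrt (Nat.cast_nonneg T : (0 : ℝ) ≤ T)]
  field_simp
  ring

end Bound

/-! ### Regret along a fixed sequence of draws -/

section Pathwise

variable {d T : ℕ} {ν G D ε δ : ℝ} {K : Set (Vec d)} {f : ℕ → Vec d → ℝ} {θ y : ℕ → Vec d}

lemma abs_regret_le (hf : ∀ t < T, ∀ x ∈ K, |f t x| ≤ 1) (hy : ∀ t < T, y t ∈ K) :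
    |regret K T f y| ≤ 2 * T := by
  have hsum (z : ℕ → Vec d) (hz : ∀ t < T, z t ∈ K) : |∑ t ∈ Finset.range T, f t (z t)| ≤ T := by
    refine (Finset.abs_sum_le_sum_abs _ _).trans ?_
    simpa using Finset.sum_le_card_nsmul _ _ 1 fun t ht =>
      hf t (Finset.mem_range.1 ht) _ (hz t (Finset.mem_range.1 ht))
  have hbound (x : K) := abs_le.1 (hsum (fun _ => x) fun _ _ => x.2)
  have hinf : |⨅ x : K, ∑ t ∈ Finset.range T, f t x| ≤ T := by
    cases isEmpty_or_nonempty K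
    · simp [Real.iInf_of_isEmpty]
    · refine abs_le.2 ⟨le_ciInf fun x => (hbound x).1, ?_⟩
      exact ciInf_le_of_le ⟨-T, Set.forall_mem_range.2 fun x => (hbound x).1⟩
        (Classical.arbitrary K) (hbound _).2
  rw [regret]
  linarith [abs_sub (∑ t ∈ Finset.range T, f t (y t)) (⨅ x : K, ∑ t ∈ Finset.range T, f t x),
    hsum y hy]

lemma regret_le_sum_inner (hδ : 0 ≤ δ) (hθ : ∀ t < T, ‖θ t‖ ≤ G)
    (hf : ∀ t < T, IsApproxLinear K ε (θ t) (f t)) (hy : ∀ t < T, y t ∈ K) {x : Vec d}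
    (hx : x ∈ K) (hxD : ‖x‖ ≤ D)
    (hmin : IsMinOn (fun z => inner ℝ (∑ t ∈ Finset.range T, θ t) z) K x) :
    regret K T f y ≤ ∑ t ∈ Finset.range T, inner ℝ (θ t) (y t - (1 - δ) • x) +
      δ * G * D * T + 2 * T * ε := by
  have : Nonempty K := ⟨⟨x, hx⟩⟩
  set Θ := ∑ t ∈ Finset.range T, θ t with hΘ
  have hplays : ∑ t ∈ Finset.range T, f t (y t) ≤
      ∑ t ∈ Finset.range T, inner ℝ (θ t) (y t) + T * ε := by
    rw [← nsmul_eq_mul, ← Finset.card_range T, ← Finset.sum_const, Finset.card_range,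
      ← Finset.sum_add_distrib]
    refine Finset.sum_le_sum fun t ht => ?_
    linarith [(abs_le.1 (hf t (Finset.mem_range.1 ht) _ (hy t (Finset.mem_range.1 ht)))).2]
  have hcomparator : inner ℝ Θ x - T * ε ≤ ⨅ z : K, ∑ t ∈ Finset.range T, f t z := by
    refine le_ciInf fun z => (sub_le_sub_right (hmin z.2) _).trans ?_
    beta_reduce
    rw [hΘ, sum_inner, ← nsmul_eq_mul, ← Finset.card_range T, ← Finset.sum_const,
      Finset.card_range, ← Finset.sum_sub_distrib]
    refine Finset.sum_le_sum fun t ht => ?_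
    linarith [(abs_le.1 (hf t (Finset.mem_range.1 ht) z z.2)).1]
  have hlinear : ∑ t ∈ Finset.range T, inner ℝ (θ t) (y t - (1 - δ) • x) =
      ∑ t ∈ Finset.range T, inner ℝ (θ t) (y t) - (1 - δ) * inner ℝ Θ x := by
    simp only [inner_sub_right, real_inner_smul_right, Finset.sum_sub_distrib, hΘ, sum_inner,
      Finset.mul_sum]
  have hnorm : ‖Θ‖ ≤ T * G := by
    simpa using norm_sum_le_of_le _ fun t ht => hθ t (Finset.mem_range.1 ht)
  have hshrink : -inner ℝ Θ x ≤ T * G * D :=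
    (neg_le_abs _).trans <| (abs_real_inner_le_norm _ _).trans <|
      mul_le_mul hnorm hxD (norm_nonneg _) ((norm_nonneg _).trans hnorm)
  rw [regret, hlinear]
  linarith [mul_le_mul_of_nonneg_left hshrink hδ]

namespace IsNormalBarrier

variable {R : Vec (d + 1) → ℝ} {x u : ℕ → Vec (d + 1)}

lemma sum_inner_estimator_le (hR : IsNormalBarrier (con K) ν R) (hsymm : ∀ x ∈ K, -x ∈ K)
    (hd : 1 ≤ d) (hT : 1 ≤ T) (hδ0 : 0 < δ) (hδ : δ ≤ 1 / 2)
    (hLT : 4 * d ^ 2 * (ν * Real.log (1 / δ)) ≤ T)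
    (hx : ∀ t < T, x t ∈ lift (shrink δ K))
    (hmin : ∀ t < T, IsMinOn (fun z => etaParam d T ν δ * ∑ τ ∈ Finset.range t,
      inner ℝ (estimator R (f τ) (x τ) (u τ)) z + R z) (lift (shrink δ K)) (x t))
    (hu : ∀ t < T, ‖u t‖ ≤ 1) (hf : ∀ t < T, |f t (play R (x t) (u t))| ≤ 1)
    {z : Vec (d + 1)} (hz : z ∈ lift (shrink δ K)) :
    ∑ t ∈ Finset.range T, inner ℝ (estimator R (f t) (x t) (u t)) (x t - z) ≤
      4 * d * √(ν * T * Real.log (1 / δ)) := by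
  have hδ1 : δ < 1 := by linarith
  have hL : 0 < ν * Real.log (1 / δ) :=
    mul_pos (by linarith [hR.one_le]) (Real.log_pos (one_lt_one_div hδ0 hδ1))
  have hη := etaParam_pos hd hT hL
  have hηd := etaParam_mul_le hd hT hL.le hLT
  have hbalance := etaParam_balance hd hT hL.le
  set η := etaParam d T ν δ
  have hsub := hR.cone.lift_shrink_subset_interior hsymm hδ0 hδ1
  have hsmall (t : ℕ) (ht : t < T) (h : Vec (d + 1)) :
      |η * inner ℝ (estimator R (f t) (x t) (u t)) h| ≤ η * d * localNorm R (x t) h := by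
    rw [abs_mul, abs_of_pos hη, mul_assoc]
    gcongr
    simpa using hR.abs_inner_estimator_le (hsub (hx t ht)) (hu t ht) (hf t ht) h
  refine le_of_mul_le_mul_left ?_ hη
  linarith [hR.isSelfConcordantOn.ftrl_regret_le (convex_lift_shrink hR.cone.convex_base) hsub hηd
    hx hmin hsmall hT hz, hR.sub_le_of_mem_lift hsymm hδ0 hδ (hx 0 hT) hz]

lemma sum_inner_play_sub_le (hR : IsNormalBarrier (con K) ν R) (hsymm : ∀ x ∈ K, -x ∈ K)
    (hδ0 : 0 < δ) (hδ : δ ≤ 1 / 2) (hε : 0 ≤ ε) (hx : ∀ t < T, x t ∈ lift (shrink δ K))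
    (hu : ∀ t < T, ‖u t‖ ≤ 1) (hy : ∀ t < T, play R (x t) (u t) ∈ K)
    (hf : ∀ t < T, IsApproxLinear K ε (θ t) (f t)) {w : Vec d}
    (hw : pair w 1 ∈ lift (shrink δ K)) :
    ∑ t ∈ Finset.range T, inner ℝ (θ t) (play R (x t) (u t) - w) ≤
      ∑ t ∈ Finset.range T, inner ℝ (estimator R (f t) (x t) (u t)) (x t - pair w 1) +
        2 * d * T * (ν + 2 * √ν) * ((1 - δ) / δ) * ε -
        ∑ t ∈ Finset.range T, roundError R (θ t) w (x t) (u t) := by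
  have hsub := hR.cone.lift_shrink_subset_interior hsymm hδ0 (by linarith : δ < 1)
  have hround (t : ℕ) (ht : t ∈ Finset.range T) : inner ℝ (θ t) (play R (x t) (u t) - w) ≤
      inner ℝ (estimator R (f t) (x t) (u t)) (x t - pair w 1) +
        d * ε * (2 * (ν + 2 * √ν) * ((1 - δ) / δ)) - roundError R (θ t) w (x t) (u t) := by
    have ht := Finset.mem_range.1 ht
    refine (hR.inner_play_sub_le (hsub (hx t ht)) (hu t ht) (hf t ht _ (hy t ht)) w).trans ?_
    rw [← localNorm_neg R (x t), neg_sub]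
    gcongr
    exact hR.localNorm_sub_le_of_mem_lift hsymm hδ0 hδ (hx t ht) hw
  refine (Finset.sum_le_sum hround).trans_eq ?_
  rw [Finset.sum_sub_distrib, Finset.sum_add_distrib, Finset.sum_const, Finset.card_range,
    nsmul_eq_mul]
  ring

lemma regret_le_regretBound_sub (hR : IsNormalBarrier (con K) ν R) (hsymm : ∀ x ∈ K, -x ∈ K)
    (hd : 1 ≤ d) (hT : 1 ≤ T) (hδ0 : 0 < δ) (hδ : δ ≤ 1 / 2)
    (hLT : 4 * d ^ 2 * (ν * Real.log (1 / δ)) ≤ T) (hε : 0 ≤ ε) (hθ : ∀ t < T, ‖θ t‖ ≤ G)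
    (hf : ∀ t < T, IsApproxLinear K ε (θ t) (f t)) (hf1 : ∀ t < T, ∀ x ∈ K, |f t x| ≤ 1)
    (hx : ∀ t < T, x t ∈ lift (shrink δ K))
    (hmin : ∀ t < T, IsMinOn (fun z => etaParam d T ν δ * ∑ τ ∈ Finset.range t,
      inner ℝ (estimator R (f τ) (x τ) (u τ)) z + R z) (lift (shrink δ K)) (x t))
    (hu : ∀ t < T, ‖u t‖ ≤ 1) (hy : ∀ t < T, play R (x t) (u t) ∈ K) {w : Vec d} (hw : w ∈ K)
    (hwD : ‖w‖ ≤ D) (hwmin : IsMinOn (fun z => inner ℝ (∑ t ∈ Finset.range T, θ t) z) K w) :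
    regret K T f (fun t => play R (x t) (u t)) ≤ regretBound d T ν G D ε δ -
      ∑ t ∈ Finset.range T, roundError R (θ t) ((1 - δ) • w) (x t) (u t) := by
  have hlift := pair_smul_mem_lift_shrink (by linarith : δ < 1) hw
  have hcomparator := regret_le_sum_inner hδ0.le hθ hf hy hw hwD hwmin
  have hplay := hR.sum_inner_play_sub_le hsymm hδ0 hδ hε hx hu hy hf hlift
  have hftrl := hR.sum_inner_estimator_le hsymm hd hT hδ0 hδ hLT hx hmin hu
    (fun t ht => hf1 t ht _ (hy t ht)) hlift
  rw [regretBound]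
  linarith

end IsNormalBarrier

end Pathwise

/-! ### Expected regret -/

section Run

variable {Ω : Type*} [mΩ : MeasurableSpace Ω] {P : Measure Ω} {d T : ℕ} {ν G D ε δ η : ℝ}
  {K : Set (Vec d)} {R : Vec (d + 1) → ℝ} {θ : ℕ → Vec d} {f : ℕ → Ω → Vec d → ℝ}
  {ℱ : Filtration ℕ mΩ} {x u : ℕ → Ω → Vec (d + 1)}

namespace IsRun

lemma hasCondLaw (hrun : IsRun P T K η δ R f ℱ x u) {t : ℕ} (ht : t < T) :
    HasCondLaw P (ℱ t) (u t) fun ω =>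
      uniformPerp (mulVecE (scaling R (x t ω)) (EuclideanSpace.single (Fin.last d) 1)) :=
  hrun.uniform t ht

lemma measurable_draw (hrun : IsRun P T K η δ R f ℱ x u) {t : ℕ} (ht : t < T) :
    Measurable (u t) :=
  (hrun.measurable_u t ht).mono (ℱ.le _) le_rfl

lemma mem_interior (hrun : IsRun P T K η δ R f ℱ x u) (hR : IsNormalBarrier (con K) ν R)
    (hsymm : ∀ x ∈ K, -x ∈ K) (hδ0 : 0 < δ) (hδ1 : δ < 1) {t : ℕ} (ht : t < T) (ω : Ω) :
    x t ω ∈ interior (con K) :=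
  hR.cone.lift_shrink_subset_interior hsymm hδ0 hδ1 (hrun.mem t ht ω)

lemma isProbabilityMeasure_draw (hrun : IsRun P T K η δ R f ℱ x u)
    (hR : IsNormalBarrier (con K) ν R) (hsymm : ∀ x ∈ K, -x ∈ K) (hd : 1 ≤ d) (hδ0 : 0 < δ)
    (hδ1 : δ < 1) {t : ℕ} (ht : t < T) (ω : Ω) : IsProbabilityMeasure
      (uniformPerp (mulVecE (scaling R (x t ω)) (EuclideanSpace.single (Fin.last d) 1))) :=
  isProbabilityMeasure_uniformPerp hd <|
    hR.scaling_mulVecE_ne_zero (hrun.mem_interior hR hsymm hδ0 hδ1 ht ω) (by simp)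

variable [IsProbabilityMeasure P]

lemma ae_draw (hrun : IsRun P T K η δ R f ℱ x u) (hR : IsNormalBarrier (con K) ν R)
    (hsymm : ∀ x ∈ K, -x ∈ K) (hd : 1 ≤ d) (hδ0 : 0 < δ) (hδ1 : δ < 1) :
    ∀ᵐ ω ∂P, ∀ t < T, ‖u t ω‖ = 1 ∧
      inner ℝ (mulVecE (scaling R (x t ω)) (EuclideanSpace.single (Fin.last d) 1)) (u t ω) = 0 := by
  refine ae_all_iff.2 fun t => eventually_imp_distrib_left.2 fun ht => ?_
  have hmem := hrun.mem_interior hR hsymm hδ0 hδ1 ht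
  have := hrun.isProbabilityMeasure_draw hR hsymm hd hδ0 hδ1 ht
  have hscaling : Continuous fun z : interior (con K) × Vec (d + 1) =>
      mulVecE (scaling R z.1) (EuclideanSpace.single (Fin.last d) 1) :=
    continuousOn_univ.1 <| continuousOn_mulVecE
      (hR.continuousOn_scaling.comp_continuous (by fun_prop) fun z => z.1.2).continuousOn
      continuousOn_const
  have hclosed : IsClosed {z : interior (con K) × Vec (d + 1) | ‖z.2‖ = 1 ∧
      inner ℝ (mulVecE (scaling R z.1) (EuclideanSpace.single (Fin.last d) 1)) z.2 = 0} :=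
    (isClosed_eq (by fun_prop) continuous_const).inter
      (isClosed_eq (hscaling.inner continuous_snd) continuous_const)
  exact (hrun.hasCondLaw ht).ae_of_forall_ae (ℱ.le t)
    (X := fun ω => (⟨x t ω, hmem ω⟩ : interior (con K)))
    ((hrun.measurable_x t ht).subtype_mk) (hrun.measurable_draw ht) hclosed.measurableSet
    fun ω => mem_ae_iff.2 (uniformPerp_compl_eq_zero _)

lemma ae_play_mem (hrun : IsRun P T K η δ R f ℱ x u) (hR : IsNormalBarrier (con K) ν R)
    (hsymm : ∀ x ∈ K, -x ∈ K) (hd : 1 ≤ d) (hδ0 : 0 < δ) (hδ1 : δ < 1) :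
    ∀ᵐ ω ∂P, ∀ t < T, play R (x t ω) (u t ω) ∈ K := by
  filter_upwards [hrun.ae_draw hR hsymm hd hδ0 hδ1] with ω hω t ht
  exact hR.play_mem (hrun.mem_interior hR hsymm hδ0 hδ1 ht ω) (last_of_mem_lift (hrun.mem t ht ω))
    (hω t ht).1.le (hω t ht).2

lemma integrable_roundError (hrun : IsRun P T K η δ R f ℱ x u)
    (hR : IsNormalBarrier (con K) ν R) (hsymm : ∀ x ∈ K, -x ∈ K) (hK : IsCompact K) (hd : 1 ≤ d)
    (hδ0 : 0 < δ) (hδ1 : δ < 1) (θ w : Vec d) {t : ℕ} (ht : t < T) :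
    Integrable (fun ω => roundError R θ w (x t ω) (u t ω)) P := by
  have hsub := hR.cone.lift_shrink_subset_interior hsymm hδ0 hδ1
  obtain ⟨C, hC⟩ := ((isCompact_lift_shrink hK hδ1).prod
    (isCompact_closedBall (0 : Vec (d + 1)) 1)).exists_bound_of_continuousOn <|
      (hR.continuousOn_roundError θ w).mono (Set.prod_mono hsub (Set.subset_univ _))
  have hx : Measurable fun ω => (⟨x t ω, hsub (hrun.mem t ht ω)⟩ : interior (con K)) :=
    ((hrun.measurable_x t ht).mono (ℱ.le t) le_rfl).subtype_mk
  have hmeas : Measurable fun ω => roundError R θ w (x t ω) (u t ω) := by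
    simpa only [Function.comp_def] using
      (hR.continuous_roundError_interior θ w).measurable.comp (hx.prodMk (hrun.measurable_draw ht))
  refine Integrable.of_bound hmeas.aestronglyMeasurable C ?_
  filter_upwards [hrun.ae_draw hR hsymm hd hδ0 hδ1] with ω hω
  exact hC (x t ω, u t ω) ⟨hrun.mem t ht ω, mem_closedBall_zero_iff.2 (hω t ht).1.le⟩

lemma integral_roundError (hrun : IsRun P T K η δ R f ℱ x u)
    (hR : IsNormalBarrier (con K) ν R) (hsymm : ∀ x ∈ K, -x ∈ K) (hK : IsCompact K) (hd : 1 ≤ d)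
    (hδ0 : 0 < δ) (hδ1 : δ < 1) (θ w : Vec d) {t : ℕ} (ht : t < T) :
    ∫ ω, roundError R θ w (x t ω) (u t ω) ∂P = 0 := by
  have hmem := hrun.mem_interior hR hsymm hδ0 hδ1 ht
  have := hrun.isProbabilityMeasure_draw hR hsymm hd hδ0 hδ1 ht
  refine ((hrun.hasCondLaw ht).integral_comp (ℱ.le t)
    (X := fun ω => (⟨x t ω, hmem ω⟩ : interior (con K)))
    (hrun.measurable_x t ht).subtype_mk (hrun.measurable_draw ht)
    (hR.continuous_roundError_interior θ w).measurable
    (hrun.integrable_roundError hR hsymm hK hd hδ0 hδ1 θ w ht)).trans ?_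
  exact integral_eq_zero_of_ae <| Eventually.of_forall fun ω =>
    hR.integral_roundError_uniformPerp hd (hmem ω) (last_of_mem_lift (hrun.mem t ht ω)) θ w

lemma ae_abs_regret_le (hrun : IsRun P T K η δ R f ℱ x u) (hR : IsNormalBarrier (con K) ν R)
    (hsymm : ∀ x ∈ K, -x ∈ K) (hd : 1 ≤ d) (hδ0 : 0 < δ) (hδ1 : δ < 1)
    (hf1 : ∀ t < T, ∀ ω, ∀ x ∈ K, |f t ω x| ≤ 1) :
    ∀ᵐ ω ∂P, |regret K T (fun t => f t ω) (fun t => play R (x t ω) (u t ω))| ≤ 2 * T := by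
  filter_upwards [hrun.ae_play_mem hR hsymm hd hδ0 hδ1] with ω hω
  exact abs_regret_le (fun t ht => hf1 t ht ω) hω

lemma integrable_regret (hrun : IsRun P T K η δ R f ℱ x u) (hR : IsNormalBarrier (con K) ν R)
    (hsymm : ∀ x ∈ K, -x ∈ K) (hd : 1 ≤ d) (hδ0 : 0 < δ) (hδ1 : δ < 1)
    (hf1 : ∀ t < T, ∀ ω, ∀ x ∈ K, |f t ω x| ≤ 1)
    (hinf : AEMeasurable (fun ω => ⨅ x : K, ∑ t ∈ Finset.range T, f t ω x) P) :
    Integrable (fun ω => regret K T (fun t => f t ω) (fun t => play R (x t ω) (u t ω))) P := by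
  have hplays : Measurable fun ω => ∑ t ∈ Finset.range T, f t ω (play R (x t ω) (u t ω)) :=
    Finset.measurable_fun_sum _ fun t ht =>
      (hrun.measurable_loss t (Finset.mem_range.1 ht)).mono (ℱ.le _) le_rfl
  exact Integrable.of_bound (hplays.aemeasurable.sub hinf).aestronglyMeasurable (2 * T)
    (hrun.ae_abs_regret_le hR hsymm hd hδ0 hδ1 hf1)

lemma integral_regret_le_two_mul (hrun : IsRun P T K η δ R f ℱ x u)
    (hR : IsNormalBarrier (con K) ν R) (hsymm : ∀ x ∈ K, -x ∈ K) (hd : 1 ≤ d) (hδ0 : 0 < δ)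
    (hδ1 : δ < 1) (hf1 : ∀ t < T, ∀ ω, ∀ x ∈ K, |f t ω x| ≤ 1) :
    ∫ ω, regret K T (fun t => f t ω) (fun t => play R (x t ω) (u t ω)) ∂P ≤ 2 * T := by
  refine (Real.le_norm_self _).trans ((norm_integral_le_of_norm_le_const (C := 2 * T) ?_).trans_eq
    (by rw [probReal_univ, mul_one]))
  exact hrun.ae_abs_regret_le hR hsymm hd hδ0 hδ1 hf1

lemma integral_regret_le_of_le_half (hrun : IsRun P T K (etaParam d T ν δ) δ R f ℱ x u)
    (hR : IsNormalBarrier (con K) ν R) (hsymm : ∀ x ∈ K, -x ∈ K) (hKD : K ⊆ Metric.closedBall 0 D)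
    (hd : 1 ≤ d) (hT : 1 ≤ T) (hδ0 : 0 < δ) (hδ : δ ≤ 1 / 2)
    (hLT : 4 * d ^ 2 * (ν * Real.log (1 / δ)) ≤ T) (hε : 0 ≤ ε) (hθ : ∀ t < T, ‖θ t‖ ≤ G)
    (hf : ∀ t < T, ∀ ω, IsApproxLinear K ε (θ t) (f t ω))
    (hf1 : ∀ t < T, ∀ ω, ∀ x ∈ K, |f t ω x| ≤ 1)
    (hint : Integrable (fun ω => regret K T (fun t => f t ω)
      (fun t => play R (x t ω) (u t ω))) P) :
    ∫ ω, regret K T (fun t => f t ω) (fun t => play R (x t ω) (u t ω)) ∂P ≤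
      regretBound d T ν G D ε δ := by
  have hδ1 : δ < 1 := by linarith
  have hK : IsCompact K := (isCompact_closedBall 0 D).of_isClosed_subset hR.cone.isClosed_base hKD
  have h0 : (0 : Vec d) ∈ K := mem_of_mem_nhds (hR.cone.base_mem_nhds_zero hsymm)
  obtain ⟨w, hw, hwmin⟩ := hK.exists_isMinOn ⟨0, h0⟩
    (f := fun z => inner ℝ (∑ t ∈ Finset.range T, θ t) z) (by fun_prop)
  have herr (t : ℕ) (ht : t ∈ Finset.range T) :=
    hrun.integrable_roundError hR hsymm hK hd hδ0 hδ1 (θ t) ((1 - δ) • w) (Finset.mem_range.1 ht)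
  have herr0 (t : ℕ) (ht : t ∈ Finset.range T) :=
    hrun.integral_roundError hR hsymm hK hd hδ0 hδ1 (θ t) ((1 - δ) • w) (Finset.mem_range.1 ht)
  have hpath : ∀ᵐ ω ∂P, regret K T (fun t => f t ω) (fun t => play R (x t ω) (u t ω)) ≤
      regretBound d T ν G D ε δ -
        ∑ t ∈ Finset.range T, roundError R (θ t) ((1 - δ) • w) (x t ω) (u t ω) := by
    filter_upwards [hrun.ae_draw hR hsymm hd hδ0 hδ1, hrun.ae_play_mem hR hsymm hd hδ0 hδ1]
      with ω hu hy
    exact hR.regret_le_regretBound_sub hsymm hd hT hδ0 hδ hLT hε hθ (fun t ht => hf t ht ω)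
      (fun t ht => hf1 t ht ω) (fun t ht => hrun.mem t ht ω) (fun t ht => hrun.isMinOn t ht ω)
      (fun t ht => (hu t ht).1.le) hy hw (by simpa using hKD hw) hwmin
  refine (integral_mono_ae hint
    ((integrable_const _).sub (integrable_finsetSum _ herr)) hpath).trans_eq ?_
  simp only [Pi.sub_apply]
  rw [integral_sub (integrable_const _) (integrable_finsetSum _ herr), integral_finsetSum _ herr,
    Finset.sum_eq_zero herr0, integral_const, probReal_univ, one_smul, sub_zero]

lemma integral_regret_le (hrun : IsRun P T K (etaParam d T ν δ) δ R f ℱ x u)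
    (hR : IsNormalBarrier (con K) ν R) (hsymm : ∀ x ∈ K, -x ∈ K) (hKD : K ⊆ Metric.closedBall 0 D)
    (hd : 1 ≤ d) (hT : 1 ≤ T) (hε : 0 ≤ ε) (hδ : δ = deltaParam T ε) (hδ1 : δ < 1)
    (hθ : ∀ t < T, ‖θ t‖ ≤ G) (hf : ∀ t < T, ∀ ω, IsApproxLinear K ε (θ t) (f t ω))
    (hf1 : ∀ t < T, ∀ ω, ∀ x ∈ K, |f t ω x| ≤ 1)
    (hint : Integrable (fun ω => regret K T (fun t => f t ω)
      (fun t => play R (x t ω) (u t ω))) P) :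
    ∫ ω, regret K T (fun t => f t ω) (fun t => play R (x t ω) (u t ω)) ∂P ≤
      regretBound d T ν G D ε δ := by
  have hδ0 : 0 < δ := hδ ▸ deltaParam_pos hT hε
  have hG : 0 ≤ G := (norm_nonneg _).trans (hθ 0 hT)
  have hD : 0 ≤ D := by
    simpa using hKD (mem_of_mem_nhds (hR.cone.base_mem_nhds_zero hsymm))
  have htrivial := hrun.integral_regret_le_two_mul hR hsymm hd hδ0 hδ1 hf1
  rcases lt_or_ge (1 / 2) δ with hhalf | hhalf
  · subst hδ
    refine htrivial.trans ?_
    simpa only [sq_deltaParam_eq hT hε hδ1 hhalf] using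
      two_mul_le_regretBound_of_half_le hd hR.one_le (mul_nonneg hG hD) hhalf.le hδ1
  rcases le_total (T : ℝ) (4 * d ^ 2 * (ν * Real.log (1 / δ))) with hLT | hLT
  · exact htrivial.trans <| two_mul_le_regretBound_of_le hd (zero_le_one.trans hR.one_le)
      (mul_nonneg hG hD) hε hδ0 hδ1 hLT
  · exact hrun.integral_regret_le_of_le_half hR hsymm hKD hd hT hδ0 hhalf hLT hε hθ hf hf1 hint

end IsRun

end Run

end BanditLifting

end

theorem theorem1_general (ν G D : ℝ) :
    (∀ (d T : ℕ) (ε δ η : ℝ), 1 ≤ d → 1 ≤ T → 0 ≤ ε →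
      δ = BanditLifting.deltaParam T ε → δ < 1 → η = BanditLifting.etaParam d T ν δ →
      ∀ (K : Set (BanditLifting.Vec d)), (∀ x ∈ K, -x ∈ K) → K ⊆ Metric.closedBall 0 D →
      ∀ (R : BanditLifting.Vec (d + 1) → ℝ),
        BanditLifting.IsNormalBarrier (BanditLifting.con K) ν R →
      ∀ (Ω : Type*) [mΩ : MeasurableSpace Ω] (P : Measure Ω) [IsProbabilityMeasure P]
        (θ : ℕ → BanditLifting.Vec d) (f : ℕ → Ω → BanditLifting.Vec d → ℝ)
        (ℱ : Filtration ℕ mΩ) (x' u : ℕ → Ω → BanditLifting.Vec (d + 1)),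
        (∀ t < T, ‖θ t‖ ≤ G) →
        (∀ t < T, ∀ ω, BanditLifting.IsApproxLinear K ε (θ t) (f t ω)) →
        (∀ t < T, ∀ ω, ∀ x ∈ K, |f t ω x| ≤ 1) →
        AEMeasurable (fun ω => ⨅ x : K, ∑ t ∈ Finset.range T, f t ω x) P →
        BanditLifting.IsRun P T K η δ R f ℱ x' u →
        Integrable (fun ω => BanditLifting.regret K T (fun t => f t ω)
          (fun t => BanditLifting.play R (x' t ω) (u t ω))) P ∧
        ∫ ω, BanditLifting.regret K T (fun t => f t ω)
          (fun t => BanditLifting.play R (x' t ω) (u t ω)) ∂P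
          ≤ BanditLifting.regretBound d T ν G D ε δ) ∧
    (∃ C : ℝ, ∀ (d T : ℕ) (ε δ : ℝ), 1 ≤ d → 1 ≤ T → 0 ≤ ε →
      δ = BanditLifting.deltaParam T ε → δ < 1 →
      BanditLifting.regretBound d T ν G D ε δ
        ≤ C * (√(Real.log (1 / δ)) * (d * √T) + √ε * d * T + ε * d * T)) := by
  refine ⟨?_, 4 * √ν + 2 * (|ν| + 2 * √ν) + |G * D| + 2, fun d T ε δ hd hT hε hδ hδ1 => ?_⟩
  · rintro d T ε δ η hd hT hε hδ hδ1 rfl K hsymm hKD R hR Ω mΩ P hP θ f ℱ x' u hθ hf hf1 hinf hrun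
    have hδ0 : 0 < δ := hδ ▸ BanditLifting.deltaParam_pos hT hε
    have hint := hrun.integrable_regret hR hsymm hd hδ0 hδ1 hf1 hinf
    exact ⟨hint, hrun.integral_regret_le hR hsymm hKD hd hT hε hδ hδ1 hθ hf hf1 hint⟩
  · subst hδ
    exact BanditLifting.regretBound_deltaParam_le hd hT hε hδ1

theorem theorem1 (ν G D : ℝ) (hD : 1 ≤ D) :
    -- the bound on the expected regret
    (∀ (d T : ℕ) (ε δ η : ℝ), 1 ≤ d → 1 ≤ T → 0 ≤ ε →
      δ = BanditLifting.deltaParam T ε → δ < 1 → η = BanditLifting.etaParam d T ν δ →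
      ∀ (K : Set (BanditLifting.Vec d)), K = Metric.closedBall 0 D →
      ∀ (R : BanditLifting.Vec (d + 1) → ℝ),
        BanditLifting.IsNormalBarrier (BanditLifting.con K) ν R →
      ∀ (Ω : Type*) [mΩ : MeasurableSpace Ω] (P : Measure Ω) [IsProbabilityMeasure P]
        (θ : ℕ → BanditLifting.Vec d) (f : ℕ → Ω → BanditLifting.Vec d → ℝ)
        (ℱ : Filtration ℕ mΩ) (x' u : ℕ → Ω → BanditLifting.Vec (d + 1)),
        (∀ t < T, ‖θ t‖ ≤ G) →
        (∀ t < T, ∀ ω, BanditLifting.IsApproxLinear K ε (θ t) (f t ω)) →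
        (∀ t < T, ∀ ω, ∀ x ∈ K, |f t ω x| ≤ 1) →
        AEMeasurable (fun ω => ⨅ x : K, ∑ t ∈ Finset.range T, f t ω x) P →
        BanditLifting.IsRun P T K η δ R f ℱ x' u →
        Integrable (fun ω => BanditLifting.regret K T (fun t => f t ω)
          (fun t => BanditLifting.play R (x' t ω) (u t ω))) P ∧
        ∫ ω, BanditLifting.regret K T (fun t => f t ω)
          (fun t => BanditLifting.play R (x' t ω) (u t ω)) ∂P
          ≤ BanditLifting.regretBound d T ν G D ε δ) ∧
    -- the order of this bound, up to the logarithmic factor `√(ln (1 / δ))`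
    (∃ C : ℝ, ∀ (d T : ℕ) (ε δ : ℝ), 1 ≤ d → 1 ≤ T → 0 ≤ ε →
      δ = BanditLifting.deltaParam T ε → δ < 1 →
      BanditLifting.regretBound d T ν G D ε δ
        ≤ C * (√(Real.log (1 / δ)) * (d * √T) + √ε * d * T + ε * d * T)) := by
  exact (theorem1_general ν G D).imp_left fun h d T ε δ η hd hT hε hδ hδ1 hη K hK =>
    h d T ε δ η hd hT hε hδ hδ1 hη K (by simp [hK]) hK.subset
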